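/- Notation. Let $\mathbb T=\mathbb R/2\pi\mathbb Z$ and, for $\varphi:\mathbb T\to\mathbb R$, let $\hat\varphi_k=\frac1{2\pi}\int_{\mathbb T}\varphi(x)e^{-ikx}\,dx$. For $0<\alpha<\frac12$ let $$\mathcal L_\alpha\varphi(x)=\sum_{k\in\mathbb Z} i\,k|k|^{2\alpha-1}\hat\varphi_k e^{ikx}.$$ Fix an even $\psi\in C_c^\infty(\mathbb R)$ with $\psi=1$ on $(-\frac34,\frac34)$ and $\operatorname{supp}\psi\subset(-1,1)$. Put $\psi_{-1}=\psi$ and $\psi_q(\xi)=\psi(2^{-q-1}\xi)-\psi(2^{-q}\xi)$ for integers $q\ge0$, and let $\Delta_q\varphi=\sum_{k\in\mathbb Z}\psi_q(k)\hat\varphi_ke^{ikx}$. For $s\in\mathbb R$ and $1\le r\le\infty$ let $\|\varphi\|_{B^s_{r,1}}=\sum_{q\ge-1}2^{qs}\|\Delta_q\varphi\|_{L^r(\mathbb T)}$. Model equation. Let $T>0$, let $f\mapsto\overline f$ be a map sending functions on $\mathbb T\times[0,T]$ to functions on $\mathbb T\times[0,T]$, and for each $t\in[0,T]$ let $F_t:C^\infty(\mathbb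 T)\to\mathbb R$ be linear. A function $f:\mathbb T\times[0,T]\to\mathbb R$ is a weak solution on $[0,T]$ of $$\partial_t f=\mathcal L_\alpha\overline f+F_t,\qquad f|_{t=0}=f_0,$$ if $f\in L^\infty(0,T;L^1(\mathbb T))$ with $f(\cdot,t)\in L^1(\mathbb T)$ for every $t\in[0,T]$, $\overline f\in L^1(\mathbb T\times[0,T])$, the function $t\mapsto F_t(\varphi(\cdot,t))$ is integrable on $[0,T]$ for every $\varphi\in C^\infty(\mathbb T\times\mathbb R)$, the function $t\mapsto\int_{\mathbb T}f(x,t)\varphi(x)\,dx$ is continuous on $[0,T]$ for every $\varphi\in C^\infty(\mathbb T)$, and for every $\varphi\in C^\infty(\mathbb T\times\mathbb R)$ $$\int_{\mathbb T}f(\cdot,T)\varphi(\cdot,T)\,dx-\int_{\mathbb T}f_0\,\varphi(\cdot,0)\,dx=\int_{\mathbb T\times[0,T]}\bigl(f\,\partial_t\varphi-\overline f\,\mathcal L_\alpha\varphi\bigr)\,dx\,dt+\int_0^TF_t(\varphi(\cdot,t))\,dt.$$ Proposition. Let $0<\alpha<\frac12$, $1\le p<2$, $\delta>0$, and let $p'$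 be the Hölder conjugate of $p$. There exists an even, real-valued $f_0\in L^p(\mathbb T)$ such that the following holds. Let $T>0$, $f\mapsto\overline f$ and $(F_t)_{t\in[0,T]}$ be as above, and let $f$ be a weak solution on $[0,T]$ with initial data $f_0$. Suppose that there are constants $C<\infty$ and $t_0>0$ with 1. $\|f(\cdot,t)-\overline f(\cdot,t)\|_{L^p(\mathbb T)}\le C\,t^\delta$ for almost every $t\in(0,\min(t_0,T))$; 2. for almost every $t\in[0,T]$, $|F_t(\varphi)|\le C\,\|\varphi\|_{B^{2\alpha-\delta}_{p',1}}$ for all $\varphi\in C^\infty(\mathbb T)$. Then $$\sup_{t\in[0,T']}\|f(\cdot,t)\|_{L^p(\mathbb T)}=\infty\qquad\text{for every }T'\in(0,T],$$ where the norm is $\infty$ when $f(\cdot,t)\notin L^p(\mathbb T)$. -/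

import Mathlib

open MeasureTheory Set
open scoped ENNReal NNReal ContDiff

noncomputable section

namespace AlphaModel

instance factTwoPiPos : Fact (0 < 2 * Real.pi) := ⟨Real.two_pi_pos⟩

/-- The torus `ℝ / 2πℤ`. Its `volume` is Lebesgue measure, of total mass `2π`. -/
abbrev Torus : Type := AddCircle (2 * Real.pi)

/-- The space of real-valued smooth functions on the torus, i.e. of functions whose
`2π`-periodic lift to `ℝ` is smooth. -/
def SmoothFn : Submodule ℝ (Torus → ℝ) where
  carrier := {φ | ContDiff ℝ ∞ (fun x : ℝ => φ (x : Torus))}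
  add_mem' := by
    intro a b ha hb
    rw [Set.mem_ofPred_eq] at ha hb ⊢
    exact ha.add hb
  zero_mem' := by
    rw [Set.mem_ofPred_eq]
    exact contDiff_const
  smul_mem' := by
    intro c a ha
    rw [Set.mem_ofPred_eq] at ha ⊢
    exact contDiff_const.mul ha

/-- Smooth functions on `𝕋 × ℝ`; the time variable is written first. -/
structure SpaceTimeTest where
  toFun : ℝ → Torus → ℝ
  smooth : ContDiff ℝ ∞ (fun z : ℝ × ℝ => toFun z.1 (z.2 : Torus))

/-- The time slice `φ(·, t)` of a space-time test function, as a smooth function on the torus. -/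
def SpaceTimeTest.slice (φ : SpaceTimeTest) (t : ℝ) : SmoothFn :=
  ⟨φ.toFun t, φ.smooth.comp (contDiff_const.prodMk contDiff_id)⟩

/-- The time derivative `∂ₜ φ` of a space-time test function. -/
def SpaceTimeTest.timeDeriv (φ : SpaceTimeTest) (t : ℝ) (x : Torus) : ℝ :=
  deriv (fun s => φ.toFun s x) t

/-- The `k`-th Fourier coefficient `(2π)⁻¹ ∫ φ(x) e^{-ikx} dx`, so that
`φ = ∑ k, coeff φ k * e^{ikx}`. -/
def coeff (φ : Torus → ℝ) (k : ℤ) : ℂ := fourierCoeff (fun x => (φ x : ℂ)) k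

/-- The Fourier multiplier `L_α` with symbol `i k |k|^{2α-1}`. The symbol is conjugate-symmetric,
so that the series of a real smooth function is real; `.re` only changes the type. -/
def dispersive (α : ℝ) (φ : Torus → ℝ) (x : Torus) : ℝ :=
  (∑' k : ℤ, Complex.I * (k : ℂ) * ((|(k : ℝ)| ^ (2 * α - 1) : ℝ) : ℂ) *
    coeff φ k * fourier k x).re

/-- The cutoffs from which Littlewood-Paley decompositions are built: smooth even functions on `ℝ`
equal to `1` on `(-3/4, 3/4)` and with support inside `(-1, 1)`. -/
structure IsCutoff (ψ : ℝ → ℝ) : Prop where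
  smooth : ContDiff ℝ ∞ ψ
  even : ∀ ξ, ψ (-ξ) = ψ ξ
  eq_one : ∀ ξ ∈ Metric.ball (0 : ℝ) (3 / 4), ψ ξ = 1
  support : tsupport ψ ⊆ Metric.ball (0 : ℝ) 1

/-- The dyadic partition of unity, indexed by `j = q + 1` with `q ≥ -1`: the function with index
`0` is `ψ_{-1} = ψ`, and the one with index `q + 1` is `ψ_q = ψ(2^{-(q+1)} ·) - ψ(2^{-q} ·)`. -/
def dyadic (ψ : ℝ → ℝ) : ℕ → ℝ → ℝ
  | 0, ξ => ψ ξ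
  | q + 1, ξ => ψ (ξ / 2 ^ (q + 1)) - ψ (ξ / 2 ^ q)

/-- The Littlewood-Paley block `Δ_q φ`, indexed by `j = q + 1`. -/
def block (ψ : ℝ → ℝ) (j : ℕ) (φ : Torus → ℝ) (x : Torus) : ℂ :=
  ∑' k : ℤ, (dyadic ψ j (k : ℝ) : ℂ) * coeff φ k * fourier k x

/-- The norm of the Besov space `B^s_{r,1}(𝕋)`, namely `∑_{q ≥ -1} 2^{qs} ‖Δ_q φ‖_{L^r}`
(with `j = q + 1`). -/
def besovNorm (ψ : ℝ → ℝ) (s : ℝ) (r : ℝ≥0∞) (φ : Torus → ℝ) : ℝ≥0∞ :=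
  ∑' j : ℕ, ENNReal.ofReal ((2 : ℝ) ^ (((j : ℝ) - 1) * s)) * eLpNorm (block ψ j φ) r volume

/-- `f` is a weak solution on `[0, T]` of `∂ₜ f = L_α g + F_t` with `f|_{t=0} = f₀`, where `g` is
the function `f̄` and `F t` is a linear functional on smooth functions, for each `t`. The first
four fields say that `f ∈ L^∞(0,T; L¹(𝕋))`, with `f(·,t)` a function for each `t`, and that the
terms of the equation are meaningful. -/
structure IsWeakSolution (α T : ℝ) (F : ℝ → SmoothFn →ₗ[ℝ] ℝ) (f₀ : Torus → ℝ)
    (f g : ℝ → Torus → ℝ) : Prop where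
  measurable : AEStronglyMeasurable (Function.uncurry f)
    ((volume.restrict (Icc 0 T)).prod volume)
  integrable : ∀ t ∈ Icc 0 T, Integrable (f t) volume
  bounded : ∃ M : ℝ≥0, ∀ᵐ t ∂(volume.restrict (Icc 0 T)), eLpNorm (f t) 1 volume ≤ M
  integrable_bar : Integrable (Function.uncurry g) ((volume.restrict (Icc 0 T)).prod volume)
  integrable_forcing : ∀ φ : SpaceTimeTest, IntegrableOn (fun t => F t (φ.slice t)) (Icc 0 T)
  continuous : ∀ φ : SmoothFn,
    ContinuousOn (fun t => ∫ x : Torus, f t x * (φ : Torus → ℝ) x) (Icc 0 T)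
  equation : ∀ φ : SpaceTimeTest,
    (∫ x : Torus, f T x * φ.toFun T x) - ∫ x : Torus, f₀ x * φ.toFun 0 x =
      (∫ z : ℝ × Torus, (f z.1 z.2 * φ.timeDeriv z.1 z.2 -
          g z.1 z.2 * dispersive α (φ.toFun z.1) z.2)
        ∂((volume.restrict (Icc 0 T)).prod volume)) +
      ∫ t in Icc 0 T, F t (φ.slice t)

/-- `‖f(·,t) - g(·,t)‖_{L^p} ≲ t^δ` for small times `t`. -/
def CloseForSmallTimes (p : ℝ≥0∞) (δ T : ℝ) (f g : ℝ → Torus → ℝ) : Prop :=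
  ∃ C : ℝ≥0, ∃ t₀ : ℝ, 0 < t₀ ∧ ∀ᵐ t ∂(volume.restrict (Ioo 0 (min t₀ T))),
    eLpNorm (fun x => f t x - g t x) p volume ≤ C * ENNReal.ofReal (t ^ δ)

/-- `|F_t(φ)| ≲ ‖φ‖_{B^s_{r,1}}` for all smooth `φ`, uniformly in `t ∈ [0, T]`. -/
def ForcingBound (ψ : ℝ → ℝ) (s : ℝ) (r : ℝ≥0∞) (T : ℝ) (F : ℝ → SmoothFn →ₗ[ℝ] ℝ) : Prop :=
  ∃ C : ℝ≥0, ∀ᵐ t ∂(volume.restrict (Icc 0 T)), ∀ φ : SmoothFn,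
    ENNReal.ofReal |F t φ| ≤ C * besovNorm ψ s r (φ : Torus → ℝ)

end AlphaModel

end

noncomputable section

namespace AlphaModel

/-! ### Exponential sums -/

/-! A weak solution bounded in `L^p` forces a smallness on its initial datum that a generic `L^p`
function does not have.

Pair the datum with the kernel `V_N = ∑_{N<k≤2N} cos(kx)`, `N = 2^n`. The weak formulation is tested
against the free evolution of `V_N`, cut off smoothly between times `τ` and `2τ`. As the free wave
solves the dual equation, three terms remain: the derivative of the cutoff against `f`, the
dispersive term against `f - f̄`, and the forcing (`IsWeakSolution.norm_integral_initial_le`). With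
`a = 1/p'` and `τ = N^(ε-2α)`: - the cutoff term is controlled by the `L^{p'}` norm of the free wave
on `[τ, 2τ]`. There the second derivative test for exponential sums gives the sup bound `N^(1-ε/2)`;
interpolation with `L²` gains `N^(-ε(1/2-a))` over the trivial `N^(1-a)`. The gain is genuine
exactly because `p < 2`, i.e. `a < 1/2`; - the other two terms are integrated over a time of order
`τ`, and `t^δ`, respectively the `δ` derivatives spared in the forcing, make them smaller still for
small `ε`.

Hence the pairing is `O(N^(1/p-κ))` with `κ > 0` (`IsWeakSolution.exists_decay`). As functionals on
`L^p`, however, these pairings have norm at least of order `N^(1/p)`, as indicators of balls of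
radius `1/(2N)` show. Banach-Steinhaus then provides one datum violating the decay for every
constant (`exists_unbounded_functionals`); it depends on neither the solution nor the equation's
lower order terms. -/

theorem norm_sum_sub_mul_le (z : ℕ → ℂ) (v : ℕ → ℝ) (B : ℝ) (hz : ∀ k, ‖z k‖ = 1) (n : ℕ)
    (hv : ∀ k < n, |v k| ≤ B) (hmono : ∀ k, k + 1 < n → v k ≤ v (k + 1)) (hB : 0 ≤ B) :
    ‖∑ k ∈ Finset.range n, (z (k + 1) - z k) * (v k : ℂ)‖ ≤ 4 * B := by
  rcases n with _ | n
  · simpa using hB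
  -- Abel summation. The two boundary terms cost `2B`; by monotonicity the total variation of `v`
  -- telescopes and costs at most another `2B`.
  have habel : ∀ m : ℕ, ∑ k ∈ Finset.range (m + 1), (z (k + 1) - z k) * (v k : ℂ) =
      z (m + 1) * v m - z 0 * v 0 -
        ∑ k ∈ Finset.range m, z (k + 1) * ((v (k + 1) - v k : ℝ) : ℂ) := by
    intro m
    induction m with
    | zero => simp; ring
    | succ m ih =>
      rw [Finset.sum_range_succ, ih, Finset.sum_range_succ _ m]
      push_cast
      ring
  have hsum : ‖∑ k ∈ Finset.range n, z (k + 1) * ((v (k + 1) - v k : ℝ) : ℂ)‖ ≤ v n - v 0 := by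
    rw [← Finset.sum_range_sub]
    refine norm_sum_le_of_le _ fun k hk => ?_
    rw [norm_mul, hz, one_mul, Complex.norm_real, Real.norm_eq_abs, abs_of_nonneg]
    exact sub_nonneg.2 (hmono k (by simpa using hk))
  have h0 := abs_le.1 (hv 0 (by omega))
  have hn := abs_le.1 (hv n (by omega))
  have e1 : ‖z (n + 1) * (v n : ℂ)‖ ≤ B := by
    rw [norm_mul, hz, one_mul, Complex.norm_real]; exact hv n (by omega)
  have e2 : ‖z 0 * (v 0 : ℂ)‖ ≤ B := by
    rw [norm_mul, hz, one_mul, Complex.norm_real]; exact hv 0 (by omega)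
  rw [habel]
  refine (norm_sub_le _ _).trans ?_
  have := norm_sub_le (z (n + 1) * (v n : ℂ)) (z 0 * (v 0 : ℂ))
  linarith

/-- The inverse of `e^{ig} - 1` has constant real part `-1/2` and imaginary part `-cot(g/2)/2`.
Dividing by it turns each term of an exponential sum into a difference with a real, monotone weight.
-/
theorem exp_sub_one_mul_cot (g : ℝ) (hg : Real.sin (g / 2) ≠ 0) :
    (Complex.exp (g * Complex.I) - 1) *
      (-1 / 2 - Complex.I * ((Real.cos (g / 2) / Real.sin (g / 2) / 2 : ℝ) : ℂ)) = 1 := by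
  have hg' : (Complex.sin ((g / 2 : ℝ) : ℂ)) ≠ 0 := by
    rw [← Complex.ofReal_sin]; exact_mod_cast hg
  have h1 : Complex.exp (g * Complex.I) =
      (Complex.cos ((g / 2 : ℝ) : ℂ) + Complex.sin ((g / 2 : ℝ) : ℂ) * Complex.I) ^ 2 := by
    rw [← Complex.exp_mul_I, ← Complex.exp_nat_mul]
    congr 1
    push_cast
    ring
  rw [h1]
  push_cast at hg' ⊢
  have h2 := Complex.sin_sq_add_cos_sq ((g : ℂ) / 2)
  have hI := Complex.I_sq
  set s := Complex.sin ((g : ℂ) / 2)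
  set c := Complex.cos ((g : ℂ) / 2)
  field_simp
  have hc : c ^ 2 = 1 - s ^ 2 := by linear_combination h2
  have e : ((c + s * Complex.I) ^ 2 - 1) = 2 * s * Complex.I * (c + s * Complex.I) := by
    linear_combination hc - s ^ 2 * hI
  rw [e]
  linear_combination (-2 * s * c ^ 2 - 2 * s * s ^ 2 - 2 * s ^ 2 * c * Complex.I) * hI + 2 * s * h2

/-- The Kuzmin-Landau inequality: an exponential sum whose phase increments `g` are monotone and
stay away from `2πℤ`, in the sense that `|sin (g / 2)| ≥ s`, is at most `1 + 2 / s`. -/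
theorem norm_sum_exp_le (θ : ℕ → ℝ) (n : ℕ) (s : ℝ) (hs : 0 < s)
    (hsin : ∀ k < n, s ≤ |Real.sin ((θ (k + 1) - θ k) / 2)|)
    (hsign : ∀ k, k + 1 < n → 0 ≤ Real.sin ((θ (k + 1) - θ k) / 2) *
      Real.sin ((θ (k + 1 + 1) - θ (k + 1)) / 2))
    (hanti : ∀ k, k + 1 < n →
      0 ≤ Real.sin (((θ (k + 1) - θ k) - (θ (k + 1 + 1) - θ (k + 1))) / 2)) :
    ‖∑ k ∈ Finset.range n, Complex.exp (θ k * Complex.I)‖ ≤ 1 + 2 / s := by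
  set v : ℕ → ℝ := fun k =>
    Real.cos ((θ (k + 1) - θ k) / 2) / Real.sin ((θ (k + 1) - θ k) / 2) / 2 with hvdef
  set z : ℕ → ℂ := fun k => Complex.exp (θ k * Complex.I) with hzdef
  have hne : ∀ k < n, Real.sin ((θ (k + 1) - θ k) / 2) ≠ 0 := fun k hk h0 => by
    have := hsin k hk
    rw [h0, abs_zero] at this
    linarith
  have hz : ∀ k, ‖z k‖ = 1 := fun k => Complex.norm_exp_ofReal_mul_I _
  have hv : ∀ k < n, |v k| ≤ 1 / s / 2 := by
    intro k hk
    rw [hvdef]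
    simp only [abs_div, abs_two]
    gcongr
    · exact Real.abs_cos_le_one _
    · exact hsin k hk
  have hmono : ∀ k, k + 1 < n → v k ≤ v (k + 1) := by
    intro k hk
    have h1 := hne k (by omega)
    have h2 := hne (k + 1) hk
    have h3 := hsign k hk
    have h4 := hanti k hk
    rw [← sub_nonneg]
    -- The identity `cot b - cot a = sin(a - b) / (sin a sin b)`: the two sign hypotheses are
    -- exactly what makes the cotangents increase.
    have : v (k + 1) - v k = Real.sin (((θ (k + 1) - θ k) - (θ (k + 1 + 1) - θ (k + 1))) / 2) /
        (2 * (Real.sin ((θ (k + 1) - θ k) / 2) * Real.sin ((θ (k + 1 + 1) - θ (k + 1)) / 2))) := by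
      rw [sub_div, Real.sin_sub, hvdef]
      field_simp
    rw [this]
    positivity
  have hsplit : ∑ k ∈ Finset.range n, z k =
      (-1 / 2) * (z n - z 0) - Complex.I * ∑ k ∈ Finset.range n, (z (k + 1) - z k) * (v k : ℂ) := by
    rw [← Finset.sum_range_sub, Finset.mul_sum, Finset.mul_sum, ← Finset.sum_sub_distrib]
    refine Finset.sum_congr rfl fun k hk => ?_
    have h := exp_sub_one_mul_cot _ (hne k (by simpa using hk))
    have hz1 : z (k + 1) = z k * Complex.exp (((θ (k + 1) - θ k : ℝ) : ℂ) * Complex.I) := by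
      simp only [hzdef]
      rw [← Complex.exp_add]
      congr 1
      push_cast
      ring
    rw [hz1]
    linear_combination (-(z k)) * h
  rw [hsplit]
  refine (norm_sub_le _ _).trans ?_
  have h1 := norm_sum_sub_mul_le z v (1 / s / 2) hz n hv hmono (by positivity)
  have h2 : ‖z n - z 0‖ ≤ 2 := (norm_sub_le _ _).trans (by rw [hz, hz]; norm_num)
  rw [norm_mul, norm_mul, Complex.norm_I, one_mul]
  have h3 : ‖(-1 / 2 : ℂ)‖ = 1 / 2 := by norm_num
  rw [h3]
  have : 4 * (1 / s / 2) = 2 / s := by ring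
  linarith

/-- Jordan's inequality, reflected at `π/2`. The range must reach 2, beyond `π/2`, because phase
increments up to 4 in size are halved. -/
theorem abs_div_four_le_abs_sin (y : ℝ) (hy : |y| ≤ 2) : |y| / 4 ≤ |Real.sin y| := by
  wlog h0 : 0 ≤ y generalizing y
  · have := this (-y) (by rwa [abs_neg]) (by linarith)
    rwa [Real.sin_neg, abs_neg, abs_neg] at this
  rw [abs_of_nonneg h0] at hy ⊢
  have hpi := Real.pi_gt_three
  have hpi' := Real.pi_lt_d2
  rw [abs_of_nonneg (Real.sin_nonneg_of_nonneg_of_le_pi h0 (by linarith))]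
  rcases le_total y (Real.pi / 2) with h | h
  · refine le_trans ?_ (Real.mul_le_sin h0 h)
    rw [div_mul_eq_mul_div, le_div_iff₀ Real.pi_pos]
    nlinarith
  · rw [← Real.sin_pi_sub]
    refine le_trans ?_ (Real.mul_le_sin (x := Real.pi - y) (by linarith) (by linarith))
    rw [div_mul_eq_mul_div, le_div_iff₀ Real.pi_pos]
    nlinarith

/-- A property that passes to smaller indices holds on an initial segment. Used to locate where
decreasing phase increments cross the levels `η` and `-η`. -/
theorem exists_threshold (Q : ℕ → Prop) (n : ℕ) (hQ : ∀ k, k + 1 < n → Q (k + 1) → Q k) :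
    ∃ m ≤ n, (∀ k < m, Q k) ∧ ∀ k, m ≤ k → k < n → ¬ Q k := by
  classical
  induction n with
  | zero => exact ⟨0, le_rfl, by simp, by simp⟩
  | succ n ih =>
    obtain ⟨m, hm, h1, h2⟩ := ih fun k hk => hQ k (by omega)
    rcases Nat.lt_or_ge m n with hlt | hge
    · refine ⟨m, by omega, h1, fun k hk hkn hq => ?_⟩
      rcases Nat.lt_succ_iff_lt_or_eq.1 hkn with h | rfl
      · exact h2 k hk h hq
      · obtain ⟨j, rfl⟩ : ∃ j, k = j + 1 := ⟨k - 1, by omega⟩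
        exact h2 j (by omega) (by omega) (hQ j (by omega) hq)
    · by_cases hq : Q n
      · refine ⟨n + 1, le_rfl, fun k hk => ?_, fun k hk hk' => by omega⟩
        rcases Nat.lt_succ_iff_lt_or_eq.1 hk with h | rfl
        · exact h1 k (by omega)
        · exact hq
      · refine ⟨m, hm.trans (by omega), h1, fun k hk hkn => ?_⟩
        obtain rfl : k = n := by omega
        exact hq

/-- The second derivative test: an exponential sum whose phase increments `g` lie in `[-4, 4]` and
satisfy `g k - g (k + 1) ≥ ρ` is `O(ρ ^ (-1/2))`. -/
theorem norm_sum_exp_le_of_second_difference (θ : ℕ → ℝ) (n : ℕ) (η : ℝ) (hη : 0 < η) (hη1 : η ≤ 1)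
    (hrange : ∀ k < n, |θ (k + 1) - θ k| ≤ 4)
    (hdiff : ∀ k, k + 1 < n → η ^ 2 ≤ (θ (k + 1) - θ k) - (θ (k + 1 + 1) - θ (k + 1))) :
    ‖∑ k ∈ Finset.range n, Complex.exp (θ k * Complex.I)‖ ≤ 37 / η := by
  set g : ℕ → ℝ := fun k => θ (k + 1) - θ k with hg
  have hdiff' : ∀ k, k + 1 < n → η ^ 2 ≤ g k - g (k + 1) := hdiff
  have hpi := Real.pi_gt_three
  -- The increments decrease, so the indices split into three consecutive runs: `g ≥ η`, then `-η <
  -- g < η`, then `g ≤ -η`. The outer runs fall under the Kuzmin-Landau inequality, the middle one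
  -- is counted.
  obtain ⟨m₁, hm₁, hQ₁, hR₁⟩ := exists_threshold (fun k => η ≤ g k) n fun k hk h => by
    have := hdiff' k hk; nlinarith
  obtain ⟨m₂, hm₂, hQ₂, hR₂⟩ := exists_threshold (fun k => -η < g k) n fun k hk h => by
    have := hdiff' k hk; nlinarith
  have hm : m₁ ≤ m₂ := by
    by_contra! hlt
    have h1 := hQ₁ m₂ hlt
    exact hR₂ m₂ le_rfl (by omega) (by linarith)
  -- the blocks away from the stationary point
  have hKL : ∀ a b : ℕ, a ≤ b → b ≤ n → (∀ k, a ≤ k → k < b → η ≤ |g k|) →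
      (∀ k, a ≤ k → k + 1 < b → 0 ≤ Real.sin (g k / 2) * Real.sin (g (k + 1) / 2)) →
      ‖∑ k ∈ Finset.Ico a b, Complex.exp (θ k * Complex.I)‖ ≤ 1 + 2 / (η / 8) := by
    intro a b hab hbn h1 h2
    rw [Finset.sum_Ico_eq_sum_range]
    refine norm_sum_exp_le (fun k => θ (a + k)) (b - a) (η / 8) (by positivity) ?_ ?_ ?_
    · intro k hk
      have e1 := h1 (a + k) (by omega) (by omega)
      have e2 := hrange (a + k) (by omega)
      have e3 := abs_div_four_le_abs_sin (g (a + k) / 2) (by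
        rw [abs_div, abs_two]; simp only [hg]; linarith)
      rw [abs_div, abs_two] at e3
      refine le_trans ?_ e3
      linarith
    · intro k hk
      exact h2 (a + k) (by omega) (by omega)
    · intro k hk
      have e1 := hdiff (a + k) (by omega)
      have e2 := abs_le.1 (hrange (a + k) (by omega))
      have e3 := abs_le.1 (hrange (a + (k + 1)) (by omega))
      have e4 : 0 ≤ η ^ 2 := by positivity
      by_cases hbig : ((θ (a + (k + 1)) - θ (a + k)) -
          (θ (a + (k + 1 + 1)) - θ (a + (k + 1)))) / 2 ≤ Real.pi
      · exact Real.sin_nonneg_of_nonneg_of_le_pi (by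
          have : a + (k + 1) = a + k + 1 := rfl
          have : a + (k + 1 + 1) = a + k + 1 + 1 := rfl
          simp only [*]; linarith) hbig
      -- A drop of more than `2π` between consecutive increments in `[-4, 4]` would make the first
      -- exceed 2 and the second lie below -2, so that their sines have opposite signs, against the
      -- sign condition.
      · exfalso
        have f1 := h1 (a + k) (by omega) (by omega)
        have f2 := h1 (a + k + 1) (by omega) (by omega)
        have f3 := h2 (a + k) (by omega) (by omega)
        have f4 : (θ (a + k + 1) - θ (a + k)) - (θ (a + k + 1 + 1) - θ (a + k + 1)) > 6 := by
          have : a + (k + 1) = a + k + 1 := rfl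
          have : a + (k + 1 + 1) = a + k + 1 + 1 := rfl
          simp only [*] at hbig; linarith
        have p1 : 2 < g (a + k) := by
          simp only [hg]
          have : a + (k + 1) = a + k + 1 := rfl
          simp only [*] at e3; linarith
        have p2 : g (a + k + 1) < -2 := by
          simp only [hg]; linarith
        have p3 : 0 < Real.sin (g (a + k) / 2) := Real.sin_pos_of_pos_of_lt_pi (by linarith) (by
          simp only [hg]; linarith)
        have p4 : Real.sin (g (a + k + 1) / 2) < 0 := by
          refine Real.sin_neg_of_neg_of_neg_pi_lt (by linarith) ?_
          simp only [hg]
          have : a + (k + 1) = a + k + 1 := rfl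
          simp only [*] at e3; linarith
        nlinarith [mul_neg_of_pos_of_neg p3 p4]
  have b1 := hKL 0 m₁ (by omega) hm₁ (fun k _ hk => (hQ₁ k hk).trans (le_abs_self _)) (by
    intro k _ hk
    have e1 := hQ₁ k (by omega)
    have e2 := hQ₁ (k + 1) hk
    have e3 := abs_le.1 (hrange k (by omega))
    have e4 := abs_le.1 (hrange (k + 1) (by omega))
    refine mul_nonneg ?_ ?_ <;>
      exact Real.sin_nonneg_of_nonneg_of_le_pi (by linarith) (by simp only [hg]; linarith))
  have b3 := hKL m₂ n hm₂ le_rfl (fun k hk hk' => by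
      have := hR₂ k hk hk'
      rw [abs_of_neg (by linarith)]
      linarith) (by
    intro k hk hk'
    have e1 := hR₂ k hk (by omega)
    have e2 := hR₂ (k + 1) (by omega) hk'
    have e3 := abs_le.1 (hrange k (by omega))
    have e4 := abs_le.1 (hrange (k + 1) (by omega))
    refine mul_nonneg_of_nonpos_of_nonpos ?_ ?_ <;>
      exact Real.sin_nonpos_of_nonpos_of_neg_pi_le (by linarith) (by simp only [hg]; linarith))
  have b2 : ‖∑ k ∈ Finset.Ico m₁ m₂, Complex.exp (θ k * Complex.I)‖ ≤ 1 + 2 / η := by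
    have hc : ‖∑ k ∈ Finset.Ico m₁ m₂, Complex.exp (θ k * Complex.I)‖ ≤ ((m₂ - m₁ : ℕ) : ℝ) := by
      refine (norm_sum_le _ _).trans ?_
      simp [Complex.norm_exp_ofReal_mul_I]
    refine hc.trans ?_
    rcases Nat.eq_zero_or_pos (m₂ - m₁) with h0 | hpos
    · rw [h0, Nat.cast_zero]; positivity
    -- Each step lowers `g` by at least `η²` inside a window of width `2η`, so the middle run has at
    -- most `1 + 2/η` indices.
    have htel : ∀ j : ℕ, m₁ + j < n → (j : ℝ) * η ^ 2 ≤ g m₁ - g (m₁ + j) := by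
      intro j
      induction j with
      | zero => simp
      | succ j ih =>
        intro hj
        have e1 := ih (by omega)
        have e2 := hdiff' (m₁ + j) (by omega)
        push_cast
        have : g (m₁ + (j + 1)) = g (m₁ + j + 1) := rfl
        rw [this]
        linarith
    obtain ⟨j, hj⟩ : ∃ j, m₂ - m₁ = j + 1 := ⟨m₂ - m₁ - 1, by omega⟩
    have e1 := htel j (by omega)
    have e2 := hR₁ m₁ le_rfl (by omega)
    have e3 := hQ₂ (m₁ + j) (by omega)
    rw [hj]
    push_cast
    have : (j : ℝ) ≤ 2 / η := by
      rw [le_div_iff₀ hη]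
      have : (j : ℝ) * η * η ≤ 2 * η := by nlinarith
      exact le_of_mul_le_mul_right this hη
    linarith
  rw [Finset.range_eq_Ico, ← Finset.sum_Ico_consecutive _ (Nat.zero_le m₂) hm₂,
    ← Finset.sum_Ico_consecutive _ (Nat.zero_le m₁) hm]
  refine (norm_add₃_le).trans ?_
  -- Since `1 ≤ 1/η`, the outer runs contribute `17/η` each and the middle one `3/η`, whence 37.
  have e : (1 : ℝ) ≤ 1 / η := by rw [le_div_iff₀ hη]; linarith
  have e2 : 2 / (η / 8) = 16 * (1 / η) := by field_simp; norm_num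
  have e3 : 2 / η = 2 * (1 / η) := by ring
  have e4 : 37 / η = 37 * (1 / η) := by ring
  rw [e2] at b1 b3
  rw [e3] at b2
  rw [e4]
  linarith

/-! ### Differences of the power phase and dispersive decay -/

theorem exists_rpow_add_one_sub (r y : ℝ) (hy : 0 < y) :
    ∃ ξ ∈ Ioo y (y + 1), (y + 1) ^ r - y ^ r = r * ξ ^ (r - 1) := by
  obtain ⟨ξ, hξ, h⟩ := exists_hasDerivAt_eq_slope (fun u : ℝ => u ^ r) (fun u => r * u ^ (r - 1))
    (lt_add_one y) (fun u hu => (Real.continuousAt_rpow_const _ _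
      (Or.inl (hy.trans_le hu.1).ne')).continuousWithinAt)
    (fun u hu => Real.hasDerivAt_rpow_const (Or.inl (hy.trans hu.1).ne'))
  refine ⟨ξ, hξ, ?_⟩
  rw [h]
  ring

theorem rpow_add_one_sub_mem (σ y : ℝ) (hσ₀ : 0 < σ) (hσ₁ : σ < 1) (hy : 0 < y) :
    0 ≤ (y + 1) ^ σ - y ^ σ ∧ (y + 1) ^ σ - y ^ σ ≤ y ^ (σ - 1) := by
  obtain ⟨ξ, hξ, h⟩ := exists_rpow_add_one_sub σ y hy
  have hξ0 : 0 < ξ := hy.trans hξ.1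
  rw [h]
  refine ⟨by positivity, ?_⟩
  have h1 : ξ ^ (σ - 1) ≤ y ^ (σ - 1) := Real.rpow_le_rpow_of_nonpos hy hξ.1.le (by linarith)
  have h2 : 0 < ξ ^ (σ - 1) := by positivity
  nlinarith

/-- Two applications of the mean value theorem give `σ(1-σ) ζ^(σ-2)` with `ζ < y + 2`, and this
power is decreasing. -/
theorem le_second_difference_rpow (σ y : ℝ) (hσ₀ : 0 < σ) (hσ₁ : σ < 1) (hy : 0 < y) :
    σ * (1 - σ) * (y + 2) ^ (σ - 2) ≤
      ((y + 1) ^ σ - y ^ σ) - ((y + 1 + 1) ^ σ - (y + 1) ^ σ) := by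
  have hder : ∀ u : ℝ, 0 < u → HasDerivAt (fun u : ℝ => (u + 1) ^ σ - u ^ σ)
      (σ * (u + 1) ^ (σ - 1) - σ * u ^ (σ - 1)) u := fun u hu => by
    refine HasDerivAt.sub ?_ (Real.hasDerivAt_rpow_const (Or.inl hu.ne'))
    simpa using ((hasDerivAt_id u).add_const 1).rpow_const (p := σ)
      (Or.inl (by simp only [id]; positivity))
  obtain ⟨ξ, hξ, h⟩ := exists_hasDerivAt_eq_slope (fun u : ℝ => (u + 1) ^ σ - u ^ σ) _
    (lt_add_one y) (fun u hu => (hder u (hy.trans_le hu.1)).continuousAt.continuousWithinAt)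
    (fun u hu => hder u (hy.trans hu.1))
  have hξ0 : 0 < ξ := hy.trans hξ.1
  obtain ⟨ζ, hζ, h'⟩ := exists_rpow_add_one_sub (σ - 1) ξ hξ0
  have hζ0 : 0 < ζ := hξ0.trans hζ.1
  have h1 : (y + 2) ^ (σ - 2) ≤ ζ ^ (σ - 2) :=
    Real.rpow_le_rpow_of_nonpos hζ0 (by linarith [hζ.2, hξ.2]) (by linarith)
  have h2 : ((y + 1) ^ σ - y ^ σ) - ((y + 1 + 1) ^ σ - (y + 1) ^ σ) =
      σ * (1 - σ) * ζ ^ (σ - 2) := by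
    have h3 : σ * ((ξ + 1) ^ (σ - 1) - ξ ^ (σ - 1)) =
        (y + 1 + 1) ^ σ - (y + 1) ^ σ - ((y + 1) ^ σ - y ^ σ) := by
      rw [mul_sub, h]
      ring
    rw [h'] at h3
    rw [show σ - 1 - 1 = σ - 2 by ring] at h3
    linarith
  rw [h2]
  have : 0 < σ * (1 - σ) := mul_pos hσ₀ (by linarith)
  gcongr

theorem sum_Ioc_int_eq_sum_range {E : Type*} [AddCommMonoid E] (N : ℕ) (f : ℤ → E) :
    ∑ k ∈ Finset.Ioc (N : ℤ) (2 * N), f k = ∑ m ∈ Finset.range N, f (N + 1 + m) := by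
  symm
  refine Finset.sum_bij (fun m _ => (N : ℤ) + 1 + m) ?_ ?_ ?_ ?_
  · intro m hm
    simp only [Finset.mem_range, Finset.mem_Ioc] at hm ⊢
    omega
  · intro a _ b _ h
    omega
  · intro k hk
    simp only [Finset.mem_Ioc] at hk
    refine ⟨(k - N - 1).toNat, ?_, ?_⟩
    · simp only [Finset.mem_range]; omega
    · omega
  · intros; rfl

theorem fourier_torus_apply (k : ℤ) (y : ℝ) :
    (fourier k (y : Torus) : ℂ) = Complex.exp (((k : ℝ) * y : ℝ) * Complex.I) := by
  rw [fourier_coe_apply]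
  congr 1
  have : (Real.pi : ℂ) ≠ 0 := by exact_mod_cast Real.pi_ne_zero
  push_cast
  field_simp

theorem exists_coe_eq (x : Torus) : ∃ y : ℝ, |y| ≤ Real.pi ∧ (y : Torus) = x := by
  have hx := AddCircle.coe_equivIoc (p := 2 * Real.pi) (a := -Real.pi) (y := x)
  have h := (AddCircle.equivIoc (2 * Real.pi) (-Real.pi) x).2
  refine ⟨_, abs_le.2 ⟨h.1.le, h.2.trans (by linarith)⟩, hx⟩

/-- Dispersive decay at frequencies between `N` and `2N`. -/
theorem norm_sum_dispersive_le (σ ε t : ℝ) (hσ₀ : 0 < σ) (hσ₁ : σ < 1) (hε : ε ≤ 1) (N : ℕ)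
    (hN : 1 ≤ N) (ht₁ : (N : ℝ) ^ (ε - σ) ≤ t) (ht₂ : t * (N : ℝ) ^ (σ - 1) ≤ 1 / 2) (x : Torus) :
    ‖∑ k ∈ Finset.Ioc (N : ℤ) (2 * N),
      Complex.exp (((t * (k : ℝ) ^ σ : ℝ) : ℂ) * Complex.I) * fourier k x‖ ≤
      111 / √(σ * (1 - σ)) * (N : ℝ) ^ (1 - ε / 2) := by
  obtain ⟨y, hy, rfl⟩ := exists_coe_eq x
  have hN0 : (0 : ℝ) < N := by exact_mod_cast hN
  have hN1 : (1 : ℝ) ≤ N := by exact_mod_cast hN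
  have hc : 0 < σ * (1 - σ) := mul_pos hσ₀ (by linarith)
  have ht : 0 < t := lt_of_lt_of_le (by positivity) ht₁
  set θ : ℕ → ℝ := fun m => ((N : ℝ) + 1 + m) * y + t * ((N : ℝ) + 1 + m) ^ σ with hθ
  -- Then `η² = σ(1-σ) N^(ε-2) / 9`, a lower bound for `t σ(1-σ) (3N)^(σ-2)` when `t ≥ N^(ε-σ)`; the
  -- 9 absorbs `3^(2-σ)`. The final constant is `111 = 37 · 3`.
  set η : ℝ := √(σ * (1 - σ)) / 3 * (N : ℝ) ^ (ε / 2 - 1) with hηdef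
  have hη : 0 < η := by positivity
  have hs1 : √(σ * (1 - σ)) ≤ 1 := by
    rw [Real.sqrt_le_one]; nlinarith
  have hη1 : η ≤ 1 := by
    have : (N : ℝ) ^ (ε / 2 - 1) ≤ 1 := Real.rpow_le_one_of_one_le_of_nonpos hN1 (by linarith)
    have h0 : 0 < (N : ℝ) ^ (ε / 2 - 1) := by positivity
    rw [hηdef]
    nlinarith [Real.sqrt_nonneg (σ * (1 - σ))]
  have hsum : ∑ k ∈ Finset.Ioc (N : ℤ) (2 * N),
      Complex.exp (((t * (k : ℝ) ^ σ : ℝ) : ℂ) * Complex.I) * fourier k (y : Torus) =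
      ∑ m ∈ Finset.range N, Complex.exp (θ m * Complex.I) := by
    rw [sum_Ioc_int_eq_sum_range]
    refine Finset.sum_congr rfl fun m _ => ?_
    rw [fourier_torus_apply, ← Complex.exp_add]
    congr 1
    simp only [hθ]
    push_cast
    ring
  have hinc : ∀ m : ℕ, θ (m + 1) - θ m =
      y + t * (((N : ℝ) + 1 + m + 1) ^ σ - ((N : ℝ) + 1 + m) ^ σ) := by
    intro m
    simp only [hθ]
    push_cast
    rw [show (N : ℝ) + 1 + (m + 1) = (N : ℝ) + 1 + m + 1 by ring]
    ring
  rw [hsum]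
  refine (norm_sum_exp_le_of_second_difference θ N η hη hη1 ?_ ?_).trans (le_of_eq ?_)
  · intro m _
    rw [hinc]
    obtain ⟨h1, h2⟩ := rpow_add_one_sub_mem σ ((N : ℝ) + 1 + m) hσ₀ hσ₁ (by positivity)
    have h3 : ((N : ℝ) + 1 + m) ^ (σ - 1) ≤ (N : ℝ) ^ (σ - 1) :=
      Real.rpow_le_rpow_of_nonpos hN0 (by linarith [(Nat.cast_nonneg m : (0 : ℝ) ≤ m)])
        (by linarith)
    -- The upper bound on `t` keeps the dispersive part of an increment within `1/2`; together with
    -- `|y| ≤ π` this stays below 4.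
    have h4 := mul_le_mul_of_nonneg_left (h2.trans h3) ht.le
    have h5 := mul_nonneg ht.le h1
    have := Real.pi_lt_d2
    have hy' := abs_le.1 hy
    rw [abs_le]
    constructor <;> linarith
  · intro m hm
    rw [hinc, hinc]
    have h1 := le_second_difference_rpow σ ((N : ℝ) + 1 + m) hσ₀ hσ₁ (by positivity)
    have h2 : (3 * (N : ℝ)) ^ (σ - 2) ≤ ((N : ℝ) + 1 + m + 2) ^ (σ - 2) := by
      refine Real.rpow_le_rpow_of_nonpos (by positivity) ?_ (by linarith)
      have : (m : ℝ) + 1 + 1 ≤ N := by exact_mod_cast hm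
      linarith
    have h3 : (3 : ℝ) ^ (-2 : ℝ) ≤ 3 ^ (σ - 2) :=
      Real.rpow_le_rpow_of_exponent_le (by norm_num) (by linarith)
    have h4 : η ^ 2 = σ * (1 - σ) * (3 : ℝ) ^ (-2 : ℝ) * (N : ℝ) ^ (ε - 2) := by
      rw [hηdef, mul_pow, div_pow, Real.sq_sqrt hc.le, ← Real.rpow_natCast ((N : ℝ) ^ _),
        ← Real.rpow_mul hN0.le, Real.rpow_neg (by norm_num)]
      rw [show (ε / 2 - 1) * ((2 : ℕ) : ℝ) = ε - 2 by push_cast; ring,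
        show (3 : ℝ) ^ (2 : ℝ) = 9 by norm_num]
      ring
    have h5 : (N : ℝ) ^ (ε - 2) = (N : ℝ) ^ (ε - σ) * (N : ℝ) ^ (σ - 2) := by
      rw [← Real.rpow_add hN0]; congr 1; ring
    push_cast
    rw [show (N : ℝ) + 1 + (m + 1) = (N : ℝ) + 1 + m + 1 by ring]
    calc η ^ 2 = (N : ℝ) ^ (ε - σ) * (σ * (1 - σ) * ((3 : ℝ) ^ (-2 : ℝ) * (N : ℝ) ^ (σ - 2))) := by
          rw [h4, h5]; ring
      _ ≤ t * (σ * (1 - σ) * (3 ^ (σ - 2) * (N : ℝ) ^ (σ - 2))) := by gcongr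
      _ = t * (σ * (1 - σ) * (3 * (N : ℝ)) ^ (σ - 2)) := by
          rw [Real.mul_rpow (by norm_num) hN0.le]
      _ ≤ t * (((N : ℝ) + 1 + m + 1) ^ σ - ((N : ℝ) + 1 + m) ^ σ -
          (((N : ℝ) + 1 + m + 1 + 1) ^ σ - ((N : ℝ) + 1 + m + 1) ^ σ)) := by
          refine mul_le_mul_of_nonneg_left (le_trans ?_ h1) ht.le
          gcongr
      _ = _ := by ring
  · rw [hηdef, show (1 - ε / 2) = -(ε / 2 - 1) by ring, Real.rpow_neg hN0.le]
    have h1 : √(σ * (1 - σ)) ≠ 0 := by positivity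
    have h2 : (N : ℝ) ^ (ε / 2 - 1) ≠ 0 := by positivity
    field_simp
    norm_num

/-! ### Real trigonometric polynomials -/

/-- The real part of the trigonometric polynomial `∑ k ∈ s, c k e^{ikx}`. -/
def trigPoly (s : Finset ℤ) (c : ℤ → ℂ) (x : Torus) : ℝ := (∑ k ∈ s, c k * fourier k x).re

theorem continuous_trigPoly (s : Finset ℤ) (c : ℤ → ℂ) : Continuous (trigPoly s c) := by
  unfold trigPoly
  fun_prop

theorem norm_fourier_apply (k : ℤ) (x : Torus) : ‖(fourier k x : ℂ)‖ = 1 := by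
  rw [fourier_apply]; exact Circle.norm_coe _

theorem norm_trigPoly_le (s : Finset ℤ) (c : ℤ → ℂ) (x : Torus) :
    ‖trigPoly s c x‖ ≤ ∑ k ∈ s, ‖c k‖ := by
  refine (Complex.abs_re_le_norm _).trans ((norm_sum_le _ _).trans (le_of_eq ?_))
  simp only [norm_mul, norm_fourier_apply, mul_one]

theorem ofReal_trigPoly (s : Finset ℤ) (c : ℤ → ℂ) (x : Torus) :
    (trigPoly s c x : ℂ) = ∑ k ∈ s, (c k / 2 * fourier k x +
      (starRingEnd ℂ) (c k) / 2 * fourier (-k) x) := by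
  rw [trigPoly, Complex.re_eq_add_conj, map_sum, ← Finset.sum_add_distrib, Finset.sum_div]
  refine Finset.sum_congr rfl fun k _ => ?_
  rw [map_mul, fourier_neg]
  ring

theorem fourierCoeff_fourier_apply (k m : ℤ) :
    fourierCoeff (fun x : Torus => (fourier k x : ℂ)) m = if m = k then 1 else 0 := by
  have := congrFun (fourierCoeff_fourier (T := 2 * Real.pi) k) m
  rw [this, Pi.single_apply]

theorem coeff_trigPoly (s : Finset ℤ) (c : ℤ → ℂ) (m : ℤ) :
    coeff (trigPoly s c) m = ∑ k ∈ s, (c k / 2 * (if m = k then 1 else 0) +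
      (starRingEnd ℂ) (c k) / 2 * (if m = -k then 1 else 0)) := by
  have hint : ∀ f : Torus → ℂ, Continuous f → Integrable f AddCircle.haarAddCircle := fun f hf =>
    hf.integrable_of_hasCompactSupport (HasCompactSupport.of_compactSpace _)
  rw [coeff]
  simp_rw [ofReal_trigPoly]
  have hfun : (fun x : Torus => ∑ k ∈ s, (c k / 2 * fourier k x +
      (starRingEnd ℂ) (c k) / 2 * fourier (-k) x)) = ∑ k ∈ s, fun x : Torus =>
      (c k / 2 * fourier k x + (starRingEnd ℂ) (c k) / 2 * fourier (-k) x) := by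
    ext x; simp
  rw [hfun, fourierCoeff.sum _ _ (fun k _ => hint _ (by fun_prop))]
  rw [Finset.sum_apply]
  refine Finset.sum_congr rfl fun k _ => ?_
  rw [← fourierCoeff_fourier_apply, ← fourierCoeff_fourier_apply, ← fourierCoeff.const_mul,
    ← fourierCoeff.const_mul, ← Pi.add_apply,
    ← fourierCoeff.add (hint _ (by fun_prop)) (hint _ (by fun_prop))]
  rfl

/-- Fourier multipliers with a conjugate-symmetric symbol act on real trigonometric polynomials. -/
theorem tsum_multiplier_trigPoly (s : Finset ℤ) (c m : ℤ → ℂ)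
    (hm : ∀ k, m (-k) = (starRingEnd ℂ) (m k)) (x : Torus) :
    ∑' k : ℤ, m k * coeff (trigPoly s c) k * fourier k x =
      (trigPoly s (fun k => m k * c k) x : ℂ) := by
  have h1 : ∀ (j : ℤ) (w : ℂ), HasSum (fun k : ℤ => m k * (w * (if k = j then 1 else 0)) *
      (fourier k x : ℂ)) (m j * w * fourier j x) := by
    intro j w
    convert hasSum_single j ?_ using 1
    · simp
    · intro k hk
      simp [hk]
  have h2 : HasSum (fun k : ℤ => m k * coeff (trigPoly s c) k * (fourier k x : ℂ))
      (∑ j ∈ s, (m j * (c j / 2) * fourier j x +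
        m (-j) * ((starRingEnd ℂ) (c j) / 2) * fourier (-j) x)) := by
    refine (hasSum_sum fun j _ => (h1 j (c j / 2)).add
      (h1 (-j) ((starRingEnd ℂ) (c j) / 2))).congr_fun ?_
    intro k
    rw [coeff_trigPoly, Finset.mul_sum, Finset.sum_mul]
    refine Finset.sum_congr rfl fun j _ => ?_
    ring
  rw [h2.tsum_eq, ofReal_trigPoly]
  refine Finset.sum_congr rfl fun j _ => ?_
  rw [hm, map_mul]
  ring

/-- The dispersion relation of `L_α`. -/
def omega (α : ℝ) (k : ℤ) : ℝ := k * |(k : ℝ)| ^ (2 * α - 1)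

theorem omega_neg (α : ℝ) (k : ℤ) : omega α (-k) = -omega α k := by
  simp [omega]

theorem omega_of_pos (α : ℝ) (k : ℤ) (hk : 0 < k) : omega α k = (k : ℝ) ^ (2 * α) := by
  have hk' : (0 : ℝ) < k := by exact_mod_cast hk
  rw [omega, abs_of_pos hk', Real.rpow_sub_one hk'.ne']
  field_simp

theorem dispersive_trigPoly (α : ℝ) (s : Finset ℤ) (c : ℤ → ℂ) (x : Torus) :
    dispersive α (trigPoly s c) x = trigPoly s (fun k => Complex.I * omega α k * c k) x := by
  have h := tsum_multiplier_trigPoly s c (fun k => Complex.I * omega α k) (fun k => by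
    rw [omega_neg]; simp) x
  have h' := congrArg Complex.re h
  rw [Complex.ofReal_re] at h'
  rw [← h', dispersive]
  congr 1
  refine tsum_congr fun k => ?_
  rw [omega]
  push_cast
  ring

theorem dyadic_even (ψ : ℝ → ℝ) (hψ : IsCutoff ψ) (j : ℕ) (ξ : ℝ) :
    dyadic ψ j (-ξ) = dyadic ψ j ξ := by
  cases j with
  | zero => exact hψ.even ξ
  | succ q => simp only [dyadic, neg_div, hψ.even]

theorem block_trigPoly (ψ : ℝ → ℝ) (hψ : IsCutoff ψ) (j : ℕ) (s : Finset ℤ) (c : ℤ → ℂ)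
    (x : Torus) :
    block ψ j (trigPoly s c) x = (trigPoly s (fun k => (dyadic ψ j k : ℂ) * c k) x : ℂ) := by
  rw [block, ← tsum_multiplier_trigPoly s c (fun k => (dyadic ψ j k : ℂ)) (fun k => by
    push_cast; rw [dyadic_even ψ hψ, Complex.conj_ofReal])]

/-! ### Lebesgue and Besov norms of trigonometric polynomials -/

/-- Interpolation between `L²` and a uniform bound. -/
theorem eLpNorm_le_of_bound_of_two {X : Type*} [MeasurableSpace X] (μ : Measure X) (u : X → ℝ)
    (S L : ℝ) (hS : 0 ≤ S) (hL : 0 ≤ L) (r : ℝ≥0∞) (hr : 2 ≤ r) (hu : ∀ x, ‖u x‖ ≤ S)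
    (hu₂ : eLpNorm u 2 μ ≤ ENNReal.ofReal L) :
    eLpNorm u r μ ≤ ENNReal.ofReal (S ^ (1 - 2 * (r⁻¹).toReal) * L ^ (2 * (r⁻¹).toReal)) := by
  have hux : ∀ x, ‖u x‖ₑ ≤ ENNReal.ofReal S := fun x => by
    rw [← ofReal_norm]; exact ENNReal.ofReal_le_ofReal (hu x)
  rcases eq_or_ne r ⊤ with rfl | hrtop
  · simp only [ENNReal.inv_top, ENNReal.toReal_zero, mul_zero, sub_zero, Real.rpow_one,
      Real.rpow_zero, mul_one, eLpNorm_exponent_top]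
    exact essSup_le_of_ae_le _ (Filter.Eventually.of_forall hux)
  have hr0 : r ≠ 0 := by rintro rfl; simp at hr
  set ρ := r.toReal with hρ
  have hρ2 : 2 ≤ ρ := by
    have := ENNReal.toReal_mono hrtop hr
    simpa using this
  have h1 : ∫⁻ x, ‖u x‖ₑ ^ ρ ∂μ ≤ ENNReal.ofReal S ^ (ρ - 2) * ∫⁻ x, ‖u x‖ₑ ^ (2 : ℝ) ∂μ := by
    rw [← lintegral_const_mul' _ _ (ENNReal.rpow_ne_top_of_nonneg (by linarith)
      ENNReal.ofReal_ne_top)]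
    refine lintegral_mono fun x => ?_
    calc ‖u x‖ₑ ^ ρ = ‖u x‖ₑ ^ (ρ - 2) * ‖u x‖ₑ ^ (2 : ℝ) := by
          rw [← ENNReal.rpow_add_of_nonneg _ _ (by linarith) (by norm_num)]
          congr 1; ring
      _ ≤ _ := by
          have := ENNReal.rpow_le_rpow (hux x) (show 0 ≤ ρ - 2 by linarith)
          gcongr
  have h2 : ∫⁻ x, ‖u x‖ₑ ^ (2 : ℝ) ∂μ = eLpNorm u 2 μ ^ (2 : ℝ) := by
    rw [eLpNorm_eq_lintegral_rpow_enorm_toReal (by norm_num) (by norm_num), ← ENNReal.rpow_mul]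
    norm_num
  rw [eLpNorm_eq_lintegral_rpow_enorm_toReal hr0 hrtop, ← hρ, ENNReal.toReal_inv, ← hρ]
  have hmul : (ρ - 2) * (1 / ρ) = 1 - 2 * ρ⁻¹ := by field_simp
  have hmul' : 2 * (1 / ρ) = 2 * ρ⁻¹ := by field_simp
  have hle : 0 ≤ 1 - 2 * ρ⁻¹ := by
    rw [← hmul]; exact mul_nonneg (by linarith) (by positivity)
  calc (∫⁻ x, ‖u x‖ₑ ^ ρ ∂μ) ^ (1 / ρ)
      ≤ (ENNReal.ofReal S ^ (ρ - 2) * ENNReal.ofReal L ^ (2 : ℝ)) ^ (1 / ρ) := by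
        refine ENNReal.rpow_le_rpow (h1.trans ?_) (by positivity)
        rw [h2]
        gcongr
    _ = _ := by
        rw [ENNReal.mul_rpow_of_nonneg _ _ (by positivity), ← ENNReal.rpow_mul, ← ENNReal.rpow_mul,
          hmul, hmul', ENNReal.ofReal_rpow_of_nonneg hS hle,
          ENNReal.ofReal_rpow_of_nonneg hL (by positivity), ENNReal.ofReal_mul (by positivity)]

/-- Orthonormality of the characters, after discarding the imaginary part. The factor `√(2π)`
converts the Haar probability measure into `volume`. -/
theorem eLpNorm_two_trigPoly_le (s : Finset ℤ) (c : ℤ → ℂ) :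
    eLpNorm (trigPoly s c) 2 volume ≤
      ENNReal.ofReal (√(2 * Real.pi) * √(∑ k ∈ s, ‖c k‖ ^ 2)) := by
  set G : C(Torus, ℂ) := ∑ k ∈ s, c k • fourier k with hG
  have hGx : ∀ x, G x = ∑ k ∈ s, c k * fourier k x := fun x => by
    simp [hG, ContinuousMap.sum_apply]
  have h1 : eLpNorm (trigPoly s c) 2 volume ≤ eLpNorm G 2 volume :=
    eLpNorm_mono fun x => by rw [hGx]; exact Complex.abs_re_le_norm _
  have hLp : ContinuousMap.toLp 2 AddCircle.haarAddCircle ℂ G =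
      ∑ k ∈ s, c k • fourierLp (T := 2 * Real.pi) 2 k := by
    rw [hG, map_sum]
    simp [fourierLp]
  have hnorm : ‖ContinuousMap.toLp 2 AddCircle.haarAddCircle ℂ G‖ = √(∑ k ∈ s, ‖c k‖ ^ 2) := by
    rw [hLp, norm_eq_sqrt_re_inner (𝕜 := ℂ), (orthonormal_fourier (T := 2 * Real.pi)).inner_sum]
    congr 1
    rw [map_sum]
    refine Finset.sum_congr rfl fun k _ => ?_
    rw [mul_comm, Complex.mul_conj, Complex.normSq_eq_norm_sq]
    exact Complex.ofReal_re _
  have h2 : eLpNorm G 2 (AddCircle.haarAddCircle (T := 2 * Real.pi)) =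
      ENNReal.ofReal (√(∑ k ∈ s, ‖c k‖ ^ 2)) := by
    rw [← hnorm, Lp.norm_def, ENNReal.ofReal_toReal (Lp.eLpNorm_ne_top _)]
    exact (eLpNorm_congr_ae (ContinuousMap.coeFn_toLp (p := 2) (𝕜 := ℂ) _ G)).symm
  refine h1.trans ?_
  have h3 : ENNReal.ofReal (√(2 * Real.pi)) =
      ENNReal.ofReal (2 * Real.pi) ^ (1 / (2 : ℝ≥0∞)).toReal := by
    rw [Real.sqrt_eq_rpow, ← ENNReal.ofReal_rpow_of_nonneg (by positivity) (by positivity)]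
    norm_num
  rw [AddCircle.volume_eq_smul_haarAddCircle, eLpNorm_smul_measure_of_ne_top (by norm_num), h2,
    ENNReal.ofReal_mul (p := √(2 * Real.pi)) (by positivity), h3, smul_eq_mul]

theorem inv_toReal_le_half (r : ℝ≥0∞) (hr : 2 ≤ r) : (r⁻¹).toReal ≤ 1 / 2 := by
  have h := ENNReal.toReal_mono (by norm_num) (ENNReal.inv_le_inv.2 hr)
  rw [ENNReal.toReal_inv 2] at h
  simpa using h

theorem card_Ioc_int (N : ℕ) : (Finset.Ioc (N : ℤ) (2 * N)).card = N := by
  rw [Int.card_Ioc]; omega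

/-- Interpolates the sup bound `S` with the `L²` bound `√(2π) A √N` for `N` coefficients; 7
dominates the remaining power of `2π`. -/
theorem eLpNorm_trigPoly_le_of_bound (N : ℕ) (c : ℤ → ℂ) (A S : ℝ) (hA : 0 ≤ A) (hS : 0 ≤ S)
    (hc : ∀ k ∈ Finset.Ioc (N : ℤ) (2 * N), ‖c k‖ ≤ A)
    (hbound : ∀ x, ‖trigPoly (Finset.Ioc (N : ℤ) (2 * N)) c x‖ ≤ S) (r : ℝ≥0∞) (hr : 2 ≤ r) :
    eLpNorm (trigPoly (Finset.Ioc (N : ℤ) (2 * N)) c) r volume ≤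
      ENNReal.ofReal (7 * (S ^ (1 - 2 * (r⁻¹).toReal) * (A ^ (2 * (r⁻¹).toReal) *
        (N : ℝ) ^ (r⁻¹).toReal))) := by
  have hsum : √(∑ k ∈ Finset.Ioc (N : ℤ) (2 * N), ‖c k‖ ^ 2) ≤ A * √N := by
    rw [← Real.sqrt_sq hA, ← Real.sqrt_mul (by positivity)]
    refine Real.sqrt_le_sqrt ?_
    refine (Finset.sum_le_card_nsmul _ _ (A ^ 2) fun k hk => ?_).trans (le_of_eq ?_)
    · have := hc k hk
      gcongr
    · rw [card_Ioc_int, nsmul_eq_mul]; ring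
  have h := eLpNorm_le_of_bound_of_two volume _ S (√(2 * Real.pi) * (A * √N)) hS (by positivity)
    r hr hbound ((eLpNorm_two_trigPoly_le _ _).trans (ENNReal.ofReal_le_ofReal (by gcongr)))
  refine h.trans (ENNReal.ofReal_le_ofReal ?_)
  have ha := inv_toReal_le_half r hr
  have ha0 : 0 ≤ (r⁻¹).toReal := ENNReal.toReal_nonneg
  set a := (r⁻¹).toReal
  have hsq : ∀ y : ℝ, 0 ≤ y → √y ^ (2 * a) = y ^ a := fun y hy => by
    rw [Real.sqrt_eq_rpow, ← Real.rpow_mul hy]; congr 1; ring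
  rw [Real.mul_rpow (by positivity) (by positivity), Real.mul_rpow hA (by positivity),
    hsq _ (by positivity), hsq _ (by positivity)]
  have hpi : (2 * Real.pi) ^ a ≤ 7 := by
    have h1 : (2 * Real.pi) ^ a ≤ (2 * Real.pi) ^ (1 : ℝ) :=
      Real.rpow_le_rpow_of_exponent_le (by linarith [Real.pi_gt_three]) (by linarith)
    rw [Real.rpow_one] at h1
    linarith [Real.pi_lt_d2]
  calc S ^ (1 - 2 * a) * ((2 * Real.pi) ^ a * (A ^ (2 * a) * (N : ℝ) ^ a))
      = (2 * Real.pi) ^ a * (S ^ (1 - 2 * a) * (A ^ (2 * a) * (N : ℝ) ^ a)) := by ring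
    _ ≤ _ := by gcongr

/-- The case without cancellation: the triangle inequality gives `S = A N`. -/
theorem eLpNorm_trigPoly_le (N : ℕ) (hN : 1 ≤ N) (c : ℤ → ℂ) (A : ℝ) (hA : 0 ≤ A)
    (hc : ∀ k ∈ Finset.Ioc (N : ℤ) (2 * N), ‖c k‖ ≤ A) (r : ℝ≥0∞) (hr : 2 ≤ r) :
    eLpNorm (trigPoly (Finset.Ioc (N : ℤ) (2 * N)) c) r volume ≤
      ENNReal.ofReal (7 * A * (N : ℝ) ^ (1 - (r⁻¹).toReal)) := by
  have hN0 : (0 : ℝ) < N := by exact_mod_cast hN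
  have ha := inv_toReal_le_half r hr
  refine (eLpNorm_trigPoly_le_of_bound N c A (A * N) hA (by positivity) hc (fun x => ?_) r
    hr).trans (le_of_eq ?_)
  · refine (norm_trigPoly_le _ _ _).trans
      ((Finset.sum_le_card_nsmul _ _ A hc).trans (le_of_eq ?_))
    rw [card_Ioc_int, nsmul_eq_mul]; ring
  · have ha0 : 0 ≤ (r⁻¹).toReal := ENNReal.toReal_nonneg
    set a := (r⁻¹).toReal
    congr 1
    rw [Real.mul_rpow hA hN0.le]
    have h1 : A ^ (1 - 2 * a) * A ^ (2 * a) = A := by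
      rw [← Real.rpow_add_of_nonneg hA (by linarith) (by linarith)]; simp
    have h2 : (N : ℝ) ^ (1 - 2 * a) * (N : ℝ) ^ a = (N : ℝ) ^ (1 - a) := by
      rw [← Real.rpow_add hN0]; congr 1; ring
    rw [← h2]
    linear_combination (7 * (N : ℝ) ^ (1 - 2 * a) * (N : ℝ) ^ a) * h1

theorem IsCutoff.eq_zero {ψ : ℝ → ℝ} (hψ : IsCutoff ψ) {ξ : ℝ} (hξ : 1 ≤ ξ) : ψ ξ = 0 := by
  refine image_eq_zero_of_notMem_tsupport fun h => ?_
  have := hψ.support h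
  rw [mem_ball_zero_iff, Real.norm_eq_abs] at this
  linarith [le_abs_self ξ]

theorem IsCutoff.exists_bound {ψ : ℝ → ℝ} (hψ : IsCutoff ψ) : ∃ B : ℝ, 0 ≤ B ∧ ∀ ξ, ‖ψ ξ‖ ≤ B := by
  have hc : HasCompactSupport ψ := HasCompactSupport.intro (isCompact_closedBall (0 : ℝ) 1)
    fun x hx => image_eq_zero_of_notMem_tsupport fun h =>
      hx (Metric.ball_subset_closedBall (hψ.support h))
  obtain ⟨B, hB⟩ := hc.exists_bound_of_continuous hψ.smooth.continuous
  exact ⟨B, (norm_nonneg _).trans (hB 0), hB⟩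

/-- For `2^n < k ≤ 2^(n+1)`, `ψ(k/2^m)` is 0 when `m ≤ n` and 1 when `m ≥ n + 2`, the quotient then
being at most `1/2 < 3/4`. Only differences involving `m = n + 1` survive. -/
theorem dyadic_eq_zero {ψ : ℝ → ℝ} (hψ : IsCutoff ψ) (n j : ℕ)
    (hj : j ∉ ({n + 1, n + 2} : Finset ℕ))
    (k : ℤ) (hk : k ∈ Finset.Ioc ((2 ^ n : ℕ) : ℤ) (2 * (2 ^ n : ℕ))) : dyadic ψ j k = 0 := by
  rw [Finset.mem_Ioc] at hk
  have hk1 : (2 : ℝ) ^ n ≤ k := by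
    have := hk.1.le
    exact_mod_cast this
  have hk2 : (k : ℝ) ≤ 2 * 2 ^ n := by exact_mod_cast hk.2
  simp only [Finset.mem_insert, Finset.mem_singleton, not_or] at hj
  have hpow : ∀ {a b : ℕ}, a ≤ b → (2 : ℝ) ^ a ≤ 2 ^ b := fun h =>
    pow_le_pow_right₀ one_le_two h
  rcases j with _ | q
  · exact hψ.eq_zero ((one_le_pow₀ one_le_two).trans hk1)
  · have hlarge : ∀ m ≤ n, ψ (k / 2 ^ m) = 0 := fun m hm => hψ.eq_zero <| by
      rw [le_div_iff₀ (by positivity), one_mul]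
      exact (hpow hm).trans hk1
    have hsmall : ∀ m, n + 2 ≤ m → ψ (k / 2 ^ m) = 1 := fun m hm => hψ.eq_one _ <| by
      have h0 : (0 : ℝ) < 2 ^ n := by positivity
      rw [mem_ball_zero_iff, Real.norm_eq_abs, abs_of_nonneg (div_nonneg (by linarith)
        (by positivity)), div_lt_iff₀ (by positivity)]
      have := hpow hm
      rw [pow_add] at this
      linarith
    rw [dyadic]
    rcases Nat.lt_or_ge q n with h | h
    · rw [hlarge q h.le, hlarge (q + 1) h, sub_zero]
    · rw [hsmall q (by omega), hsmall (q + 1) (by omega), sub_self]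

/-- Only two blocks are nonzero, and a block merely multiplies coefficients by a bounded factor.
Bounds in terms of coefficient size alone thus suffice, with no multiplier theorem. -/
theorem exists_besovNorm_trigPoly_le {ψ : ℝ → ℝ} (hψ : IsCutoff ψ) (s : ℝ) :
    ∃ K : ℝ, 0 ≤ K ∧ ∀ (n : ℕ) (c : ℤ → ℂ) (A : ℝ), 0 ≤ A →
      (∀ k ∈ Finset.Ioc ((2 ^ n : ℕ) : ℤ) (2 * (2 ^ n : ℕ)), ‖c k‖ ≤ A) → ∀ r : ℝ≥0∞, 2 ≤ r →
      besovNorm ψ s r (trigPoly (Finset.Ioc ((2 ^ n : ℕ) : ℤ) (2 * (2 ^ n : ℕ))) c) ≤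
        ENNReal.ofReal (K * A * ((2 ^ n : ℕ) : ℝ) ^ (s + (1 - (r⁻¹).toReal))) := by
  obtain ⟨B, hB0, hB⟩ := hψ.exists_bound
  -- `1 + 2^s` comes from the weights of the two blocks, 7 from the `L^r` bound, `2B` from a
  -- difference of two cutoffs.
  refine ⟨(1 + 2 ^ s) * (7 * (2 * B)), by positivity, fun n c A hA hc r hr => ?_⟩
  set N : ℕ := 2 ^ n with hN
  have hN1 : 1 ≤ N := Nat.one_le_two_pow
  have hN0 : (0 : ℝ) < N := by exact_mod_cast hN1
  have hNcast : (N : ℝ) = 2 ^ n := by rw [hN]; push_cast; rfl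
  set a := (r⁻¹).toReal
  have hblock : ∀ j, eLpNorm (block ψ j (trigPoly (Finset.Ioc (N : ℤ) (2 * N)) c)) r volume =
      eLpNorm (trigPoly (Finset.Ioc (N : ℤ) (2 * N)) (fun k => (dyadic ψ j k : ℂ) * c k)) r
        volume := by
    intro j
    refine eLpNorm_congr_norm_ae (Filter.Eventually.of_forall fun x => ?_)
    rw [block_trigPoly ψ hψ, Complex.norm_real]
  have hdy : ∀ j ξ, ‖dyadic ψ j ξ‖ ≤ 2 * B := by
    intro j ξ
    cases j with
    | zero => exact (hB ξ).trans (by linarith)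
    | succ q =>
      refine (norm_sub_le _ _).trans ?_
      linarith [hB (ξ / 2 ^ (q + 1)), hB (ξ / 2 ^ q)]
  have hle : ∀ j, eLpNorm (block ψ j (trigPoly (Finset.Ioc (N : ℤ) (2 * N)) c)) r volume ≤
      ENNReal.ofReal (7 * (2 * B * A) * (N : ℝ) ^ (1 - a)) := by
    intro j
    rw [hblock]
    refine eLpNorm_trigPoly_le N hN1 _ _ (by positivity) (fun k hk => ?_) r hr
    rw [norm_mul, Complex.norm_real]
    exact mul_le_mul (hdy _ _) (hc k hk) (norm_nonneg _) (by positivity)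
  rw [besovNorm, tsum_eq_sum (s := ({n + 1, n + 2} : Finset ℕ)), Finset.sum_pair (by omega)]
  · have e1 : (2 : ℝ) ^ ((((n + 1 : ℕ) : ℝ) - 1) * s) = (N : ℝ) ^ s := by
      rw [hNcast, ← Real.rpow_natCast, ← Real.rpow_mul zero_le_two]
      push_cast
      rw [add_sub_cancel_right]
    have e2 : (2 : ℝ) ^ ((((n + 2 : ℕ) : ℝ) - 1) * s) = 2 ^ s * (N : ℝ) ^ s := by
      rw [hNcast, ← Real.rpow_natCast 2 n, ← Real.rpow_mul zero_le_two,
        ← Real.rpow_add zero_lt_two]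
      push_cast
      congr 1
      ring
    rw [e1, e2]
    refine (add_le_add (mul_le_mul' le_rfl (hle _)) (mul_le_mul' le_rfl (hle _))).trans
      (le_of_eq ?_)
    rw [← ENNReal.ofReal_mul (by positivity), ← ENNReal.ofReal_mul (by positivity),
      ← ENNReal.ofReal_add (by positivity) (by positivity), Real.rpow_add hN0]
    congr 1
    ring
  · intro j hj
    rw [hblock]
    have : trigPoly (Finset.Ioc (N : ℤ) (2 * N)) (fun k => (dyadic ψ j k : ℂ) * c k) = 0 := by
      ext x
      rw [trigPoly, Finset.sum_eq_zero fun k hk => ?_]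
      · rfl
      · rw [dyadic_eq_zero hψ n j hj k hk]; simp
    rw [this, eLpNorm_zero, mul_zero]

/-! ### Test functions solving the free equation for short times -/

theorem trigPoly_add (s : Finset ℤ) (c d : ℤ → ℂ) (x : Torus) :
    trigPoly s (fun k => c k + d k) x = trigPoly s c x + trigPoly s d x := by
  simp only [trigPoly, add_mul, Finset.sum_add_distrib, Complex.add_re]

theorem trigPoly_ofReal_mul (s : Finset ℤ) (r : ℝ) (c : ℤ → ℂ) (x : Torus) :
    trigPoly s (fun k => (r : ℂ) * c k) x = r * trigPoly s c x := by
  simp only [trigPoly, mul_assoc, ← Finset.mul_sum, Complex.re_ofReal_mul]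

/-- The factor `e^{itω(k)}` by which the free evolution multiplies the `k`-th mode. -/
def phase (α t : ℝ) (k : ℤ) : ℂ := Complex.exp (((t * omega α k : ℝ) : ℂ) * Complex.I)

theorem norm_phase (α t : ℝ) (k : ℤ) : ‖phase α t k‖ = 1 := Complex.norm_exp_ofReal_mul_I _

/-- A smooth cutoff equal to `1` for `t ≤ τ` and to `0` for `t ≥ 2τ`. -/
def timeCutoff (τ t : ℝ) : ℝ := Real.smoothTransition (2 - t / τ)

theorem contDiff_timeCutoff (τ : ℝ) : ContDiff ℝ ∞ (timeCutoff τ) :=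
  Real.smoothTransition.contDiff.comp (contDiff_const.sub (contDiff_id.div_const _))

theorem norm_timeCutoff_le (τ t : ℝ) : ‖timeCutoff τ t‖ ≤ 1 := by
  rw [timeCutoff, Real.norm_eq_abs, abs_of_nonneg (Real.smoothTransition.nonneg _)]
  exact Real.smoothTransition.le_one _

theorem timeCutoff_eq_zero (τ t : ℝ) (hτ : 0 < τ) (ht : 2 * τ ≤ t) : timeCutoff τ t = 0 := by
  refine Real.smoothTransition.zero_of_nonpos ?_
  rw [sub_nonpos, le_div_iff₀ hτ]
  exact ht

theorem timeCutoff_eq_one (τ t : ℝ) (hτ : 0 < τ) (ht : t ≤ τ) : timeCutoff τ t = 1 := by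
  refine Real.smoothTransition.one_of_one_le ?_
  have : t / τ ≤ 1 := by rwa [div_le_one hτ]
  linarith

theorem deriv_timeCutoff_eq_zero (τ t : ℝ) (hτ : 0 < τ) (ht : t ∉ Icc τ (2 * τ)) :
    deriv (timeCutoff τ) t = 0 := by
  rw [mem_Icc, not_and_or, not_le, not_le] at ht
  rcases ht with h | h
  · have : timeCutoff τ =ᶠ[nhds t] fun _ => 1 := by
      filter_upwards [Iio_mem_nhds h] with u hu using timeCutoff_eq_one τ u hτ (le_of_lt hu)
    rw [this.deriv_eq, deriv_const]
  · have : timeCutoff τ =ᶠ[nhds t] fun _ => 0 := by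
      filter_upwards [Ioi_mem_nhds h] with u hu using timeCutoff_eq_zero τ u hτ (le_of_lt hu)
    rw [this.deriv_eq, deriv_const]

/-- Scaling: one bound for the fixed profile serves every `τ`, which matters because `τ` shrinks as
`N` grows. -/
theorem exists_norm_deriv_timeCutoff_le :
    ∃ K : ℝ, 0 ≤ K ∧ ∀ τ t : ℝ, 0 < τ → ‖deriv (timeCutoff τ) t‖ ≤ K / τ := by
  have hcd : ContDiff ℝ ∞ Real.smoothTransition := Real.smoothTransition.contDiff
  have hc : Continuous (deriv Real.smoothTransition) := hcd.continuous_deriv (by simp)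
  obtain ⟨K, hK⟩ := (isCompact_Icc (a := (0 : ℝ)) (b := 1)).exists_bound_of_continuousOn
    hc.continuousOn
  have hK0 : 0 ≤ K := (norm_nonneg _).trans (hK 0 (by simp))
  refine ⟨K, hK0, fun τ t hτ => ?_⟩
  by_cases ht : t ∈ Icc τ (2 * τ)
  · have hd : HasDerivAt (timeCutoff τ)
        (deriv Real.smoothTransition (2 - t / τ) * (-(1 / τ))) t := by
      have h1 : HasDerivAt Real.smoothTransition (deriv Real.smoothTransition (2 - t / τ))
          (2 - t / τ) := (hcd.differentiable (by simp) _).hasDerivAt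
      have h2 : HasDerivAt (fun u : ℝ => 2 - u / τ) (-(1 / τ)) t :=
        ((hasDerivAt_id t).div_const τ).const_sub 2
      exact h1.comp t h2
    have h3 := hK (2 - t / τ) (by
      have e1 : 1 ≤ t / τ := by rw [le_div_iff₀ hτ]; linarith [ht.1]
      have e2 : t / τ ≤ 2 := by rw [div_le_iff₀ hτ]; linarith [ht.2]
      constructor <;> linarith)
    rw [hd.deriv, norm_mul, norm_neg, norm_div, norm_one, Real.norm_of_nonneg hτ.le,
      div_eq_mul_one_div K]
    gcongr
  · rw [deriv_timeCutoff_eq_zero τ t hτ ht, norm_zero]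
    positivity

theorem continuous_phase (α : ℝ) (k : ℤ) : Continuous fun t => phase α t k := by
  unfold phase
  fun_prop

/-- The free wave with initial data `∑ k ∈ s, cos (k x)`, cut off for `t` beyond `τ`. -/
def freeWave (α τ : ℝ) (s : Finset ℤ) : SpaceTimeTest where
  toFun t x := trigPoly s (fun k => (timeCutoff τ t : ℂ) * phase α t k) x
  smooth := by
    simp only [trigPoly, fourier_torus_apply, phase]
    have h0 : ContDiff ℝ ∞ fun z : ℝ × ℝ => (timeCutoff τ z.1 : ℂ) :=
      Complex.ofRealCLM.contDiff.comp ((contDiff_timeCutoff τ).comp contDiff_fst)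
    have h1 : ∀ k : ℤ, ContDiff ℝ ∞ fun z : ℝ × ℝ =>
        Complex.exp (((z.1 * omega α k : ℝ) : ℂ) * Complex.I) := fun k =>
      ((Complex.ofRealCLM.contDiff.comp (contDiff_fst.mul contDiff_const)).mul contDiff_const).cexp
    have h2 : ∀ k : ℤ, ContDiff ℝ ∞ fun z : ℝ × ℝ =>
        Complex.exp ((((k : ℝ) * z.2 : ℝ) : ℂ) * Complex.I) := fun k =>
      ((Complex.ofRealCLM.contDiff.comp (contDiff_const.mul contDiff_snd)).mul contDiff_const).cexp
    exact Complex.reCLM.contDiff.comp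
      (ContDiff.sum fun k _ => (h0.mul (h1 k)).mul (h2 k))

theorem dispersive_freeWave (α τ t : ℝ) (s : Finset ℤ) (x : Torus) :
    dispersive α ((freeWave α τ s).toFun t) x = trigPoly s
      (fun k => Complex.I * omega α k * ((timeCutoff τ t : ℂ) * phase α t k)) x :=
  dispersive_trigPoly α s _ x

/-- The phase solves the free equation exactly, so the cutoff is the only source of error. -/
theorem timeDeriv_freeWave (α τ t : ℝ) (s : Finset ℤ) (x : Torus) :
    (freeWave α τ s).timeDeriv t x = deriv (timeCutoff τ) t * trigPoly s (phase α t) x +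
      dispersive α ((freeWave α τ s).toFun t) x := by
  have hχ : HasDerivAt (fun u => (timeCutoff τ u : ℂ)) ((deriv (timeCutoff τ) t : ℝ) : ℂ) t :=
    (((contDiff_timeCutoff τ).differentiable (by simp)) t).hasDerivAt.ofReal_comp
  have hp : ∀ k, HasDerivAt (fun u => phase α u k) (phase α t k * (omega α k * Complex.I)) t := by
    intro k
    have h1 : HasDerivAt (fun u : ℝ => ((u * omega α k : ℝ) : ℂ)) (omega α k : ℂ) t := by
      simpa using ((hasDerivAt_id t).mul_const (omega α k)).ofReal_comp
    exact (h1.mul_const Complex.I).cexp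
  have hsum : HasDerivAt (fun u => ∑ k ∈ s, (timeCutoff τ u : ℂ) * phase α u k * fourier k x)
      (∑ k ∈ s, (((deriv (timeCutoff τ) t : ℝ) : ℂ) * phase α t k +
        (timeCutoff τ t : ℂ) * (phase α t k * (omega α k * Complex.I))) * fourier k x) t :=
    HasDerivAt.fun_sum fun k _ => (hχ.mul (hp k)).mul_const _
  have hre : HasDerivAt (fun u => (freeWave α τ s).toFun u x) _ t :=
    Complex.reCLM.hasFDerivAt.comp_hasDerivAt t hsum
  rw [SpaceTimeTest.timeDeriv, hre.deriv, ← trigPoly_ofReal_mul, dispersive_freeWave,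
    ← trigPoly_add, trigPoly, Complex.reCLM_apply]
  congr 1
  refine Finset.sum_congr rfl fun k _ => ?_
  ring

/-! ### Duality -/

theorem norm_integral_mul_le {X : Type*} [MeasurableSpace X] {μ : Measure X} {p p' : ℝ≥0∞}
    (hpp' : p⁻¹ + p'⁻¹ = 1) {u v : X → ℝ} (hu : AEStronglyMeasurable u μ)
    (hv : AEStronglyMeasurable v μ) (A D : ℝ) (hA : 0 ≤ A)
    (hD : 0 ≤ D) (huA : eLpNorm u p μ ≤ ENNReal.ofReal A)
    (hvD : eLpNorm v p' μ ≤ ENNReal.ofReal D) :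
    ‖∫ x, u x * v x ∂μ‖ ≤ A * D := by
  have : ENNReal.HolderTriple p p' 1 := ⟨by rw [hpp', inv_one]⟩
  have h1 : ‖∫ x, u x * v x ∂μ‖ₑ ≤ ENNReal.ofReal (A * D) := by
    refine (enorm_integral_le_lintegral_enorm _).trans ?_
    rw [← eLpNorm_one_eq_lintegral_enorm, ENNReal.ofReal_mul hA]
    exact (eLpNorm_smul_le_mul_eLpNorm hv hu).trans (mul_le_mul' huA hvD)
  rw [← ofReal_norm] at h1
  exact (ENNReal.ofReal_le_ofReal_iff (by positivity)).1 h1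

theorem continuous_trigPoly_prod (s : Finset ℤ) (c : ℝ → ℤ → ℂ)
    (hc : ∀ k, Continuous fun t => c t k) :
    Continuous fun z : ℝ × Torus => trigPoly s (c z.1) z.2 := by
  unfold trigPoly
  have h : ∀ k, Continuous fun z : ℝ × Torus => c z.1 k := fun k => (hc k).comp continuous_fst
  fun_prop

theorem integrable_mul_trigPoly (s : Finset ℤ) (c : ℝ → ℤ → ℂ)
    (hc : ∀ k, Continuous fun t => c t k) (A : ℤ → ℝ) (hA : ∀ t k, ‖c t k‖ ≤ A k)
    {μ : Measure (ℝ × Torus)} {G : ℝ × Torus → ℝ} (hG : Integrable G μ) :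
    Integrable (fun z => G z * trigPoly s (c z.1) z.2) μ :=
  hG.mul_bdd (c := ∑ k ∈ s, A k) (continuous_trigPoly_prod s c hc).aestronglyMeasurable
    (Filter.Eventually.of_forall fun _ => (norm_trigPoly_le _ _ _).trans
      (Finset.sum_le_sum fun k _ => hA _ k))

theorem IsWeakSolution.integrable_uncurry {α T : ℝ} {F : ℝ → SmoothFn →ₗ[ℝ] ℝ} {f₀ : Torus → ℝ}
    {f g : ℝ → Torus → ℝ} (h : IsWeakSolution α T F f₀ f g) :
    Integrable (Function.uncurry f) ((volume.restrict (Icc 0 T)).prod volume) := by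
  obtain ⟨M, hM⟩ := h.bounded
  rw [integrable_prod_iff h.measurable]
  refine ⟨?_, ?_⟩
  · filter_upwards [ae_restrict_mem measurableSet_Icc] with t ht using h.integrable t ht
  · refine Integrable.of_bound (C := M) h.measurable.norm.integral_prod_right' ?_
    filter_upwards [hM, ae_restrict_mem measurableSet_Icc] with t ht htT
    rw [Real.norm_of_nonneg (integral_nonneg fun _ => norm_nonneg _)]
    rw [eLpNorm_one_eq_lintegral_enorm] at ht
    have h1 := integral_norm_eq_lintegral_enorm (h.integrable t htT).aestronglyMeasurable
    rw [Function.uncurry_def]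
    rw [h1]
    exact ENNReal.toReal_le_of_le_ofReal M.2 (by simpa using ht)

/-! ### Testing a weak solution against a free wave -/

theorem integral_indicator_Icc_le (T a b B : ℝ) (hab : a ≤ b) (hB : 0 ≤ B) :
    ∫ t in Icc 0 T, (Icc a b).indicator (fun _ => B) t ≤ (b - a) * B := by
  have h1 : ∫ t in Icc 0 T, (Icc a b).indicator (fun _ => B) t ≤
      ∫ t, (Icc a b).indicator (fun _ => B) t := by
    refine setIntegral_le_integral ?_ (Filter.Eventually.of_forall fun t =>
      indicator_nonneg (fun _ _ => hB) t)
    exact (integrable_indicator_iff measurableSet_Icc).2 (integrableOn_const (by simp))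
  refine h1.trans (le_of_eq ?_)
  rw [integral_indicator measurableSet_Icc, setIntegral_const, Real.volume_real_Icc_of_le hab,
    smul_eq_mul]

theorem norm_integral_le_of_norm_le_indicators (T τ B₁ B₂ : ℝ) (hτ : 0 ≤ τ) (hB₁ : 0 ≤ B₁)
    (hB₂ : 0 ≤ B₂) (H : ℝ → ℝ) (hH : ∀ᵐ t ∂(volume.restrict (Icc 0 T)), ‖H t‖ ≤
      (Icc τ (2 * τ)).indicator (fun _ => B₁) t + (Icc 0 (2 * τ)).indicator (fun _ => B₂) t) :
    ‖∫ t in Icc 0 T, H t‖ ≤ τ * B₁ + 2 * τ * B₂ := by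
  have hint : ∀ a b B : ℝ, Integrable ((Icc a b).indicator fun _ : ℝ => B)
      (volume.restrict (Icc 0 T)) := fun a b B =>
    ((integrable_indicator_iff measurableSet_Icc).2 (integrableOn_const (by simp))).integrableOn
  refine (norm_integral_le_of_norm_le ((hint τ (2 * τ) B₁).add (hint 0 (2 * τ) B₂)) hH).trans ?_
  have h1 := integral_indicator_Icc_le T τ (2 * τ) B₁ (by linarith) hB₁
  have h2 := integral_indicator_Icc_le T 0 (2 * τ) B₂ (by linarith) hB₂
  simp only [Pi.add_apply]
  rw [integral_add (hint τ (2 * τ) B₁) (hint 0 (2 * τ) B₂)]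
  linarith

/-- The cut-off free wave vanishes at time `T`, so the weak formulation expresses the initial
pairing through three errors. `D₁`, `D₂`, `D₃` bound the wave in the norm dual to each; `D₁` is
needed only on `[τ, 2τ]`, where dispersion has acted. -/
theorem IsWeakSolution.norm_integral_initial_le {ψ : ℝ → ℝ} {α T T' t₁ δ r τ : ℝ}
    {F : ℝ → SmoothFn →ₗ[ℝ] ℝ} {f₀ : Torus → ℝ} {f g : ℝ → Torus → ℝ}
    (h : IsWeakSolution α T F f₀ f g) {p p' : ℝ≥0∞} (hpp' : p⁻¹ + p'⁻¹ = 1) (hδ : 0 ≤ δ)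
    (s : Finset ℤ) {K M C₁ C₂ D₁ D₂ D₃ : ℝ}
    (hτ : 0 < τ) (hτT : 2 * τ ≤ T') (hT' : T' ≤ T) (hτt : 2 * τ < t₁)
    (hK0 : 0 ≤ K) (hK : ∀ t, ‖deriv (timeCutoff τ) t‖ ≤ K / τ)
    (hM0 : 0 ≤ M) (hM : ∀ t ∈ Icc 0 T', eLpNorm (f t) p volume ≤ ENNReal.ofReal M)
    (hC₁ : 0 ≤ C₁) (hclose : ∀ᵐ t : ℝ, t ∈ Ioo 0 t₁ →
      eLpNorm (fun x => f t x - g t x) p volume ≤ ENNReal.ofReal (C₁ * t ^ δ))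
    (hC₂ : 0 ≤ C₂) (hforce : ∀ᵐ t : ℝ, t ∈ Icc 0 T → ∀ φ : SmoothFn,
      ENNReal.ofReal |F t φ| ≤ ENNReal.ofReal C₂ * besovNorm ψ r p' (φ : Torus → ℝ))
    (hD₁0 : 0 ≤ D₁) (hD₁ : ∀ t ∈ Icc τ (2 * τ),
      eLpNorm (trigPoly s (phase α t)) p' volume ≤ ENNReal.ofReal D₁)
    (hD₂0 : 0 ≤ D₂) (hD₂ : ∀ t, eLpNorm (dispersive α ((freeWave α τ s).toFun t)) p' volume ≤
      ENNReal.ofReal D₂)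
    (hD₃0 : 0 ≤ D₃) (hD₃ : ∀ t, besovNorm ψ r p' ((freeWave α τ s).toFun t) ≤
      ENNReal.ofReal D₃) :
    ‖∫ x, f₀ x * trigPoly s (phase α 0) x‖ ≤
      τ * (K / τ * (M * D₁)) + 2 * τ * (C₁ * (2 * τ) ^ δ * D₂ + C₂ * D₃) := by
  set φ := freeWave α τ s with hφ
  have hzero : ∀ t, 2 * τ ≤ t → φ.toFun t = 0 := by
    intro t ht
    ext x
    change trigPoly s _ x = 0
    rw [trigPoly, Finset.sum_eq_zero]
    · rfl
    · intro k _
      rw [timeCutoff_eq_zero τ t hτ ht]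
      simp
  have hdisp0 : ∀ t, 2 * τ ≤ t → dispersive α (φ.toFun t) = 0 := by
    intro t ht
    ext x
    rw [dispersive_freeWave, trigPoly, Finset.sum_eq_zero]
    · rfl
    · intro k _
      rw [timeCutoff_eq_zero τ t hτ ht]
      simp
  have hinit : φ.toFun 0 = trigPoly s (phase α 0) := by
    ext x
    change trigPoly s _ x = _
    rw [timeCutoff_eq_one τ 0 hτ hτ.le]
    simp
  -- integrability on space-time
  have hcd : ContDiff ℝ ∞ (timeCutoff τ) := contDiff_timeCutoff τ
  have hcder : Continuous (deriv (timeCutoff τ)) := hcd.continuous_deriv (by simp)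
  have hcc := hcd.continuous
  have hfI := h.integrable_uncurry
  have hgI := h.integrable_bar
  have hcph := continuous_phase α
  have hdispc : ∀ k, Continuous fun t =>
      Complex.I * omega α k * ((timeCutoff τ t : ℂ) * phase α t k) := fun k => by
    have := hcph k
    fun_prop
  have hdispb : ∀ t k, ‖Complex.I * omega α k * ((timeCutoff τ t : ℂ) * phase α t k)‖ ≤
      |omega α k| := by
    intro t k
    rw [norm_mul, norm_mul, norm_mul, Complex.norm_I, norm_phase, Complex.norm_real,
      Complex.norm_real, one_mul, mul_one]
    exact mul_le_of_le_one_right (norm_nonneg _) (norm_timeCutoff_le _ _)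
  have hderc : ∀ k, Continuous fun t => ((deriv (timeCutoff τ) t : ℝ) : ℂ) * phase α t k :=
    fun k => by
    have := hcph k
    fun_prop
  have hderb : ∀ t k, ‖((deriv (timeCutoff τ) t : ℝ) : ℂ) * phase α t k‖ ≤ K / τ := by
    intro t k
    rw [norm_mul, norm_phase, Complex.norm_real, mul_one]
    exact hK t
  have hI₁ := integrable_mul_trigPoly s _ hderc (fun _ => K / τ) hderb hfI
  have hI₂ := integrable_mul_trigPoly s _ hdispc (fun k => |omega α k|) hdispb (hfI.sub hgI)
  -- Writing `f ∂ₜφ - f̄ Lφ = f (∂ₜφ - Lφ) + (f - f̄) Lφ` puts the cutoff error on `f` and the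
  -- derivative loss on the small difference.
  have hEq : ∀ z : ℝ × Torus, f z.1 z.2 * φ.timeDeriv z.1 z.2 -
      g z.1 z.2 * dispersive α (φ.toFun z.1) z.2 =
      Function.uncurry f z * trigPoly s
        (fun k => ((deriv (timeCutoff τ) z.1 : ℝ) : ℂ) * phase α z.1 k) z.2 +
      (Function.uncurry f - Function.uncurry g) z * trigPoly s
        (fun k => Complex.I * omega α k * ((timeCutoff τ z.1 : ℂ) * phase α z.1 k)) z.2 := by
    intro z
    rw [timeDeriv_freeWave, trigPoly_ofReal_mul, ← dispersive_freeWave]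
    simp only [Function.uncurry, Pi.sub_apply]
    ring
  have hweak := h.equation φ
  simp_rw [hEq] at hweak
  rw [integral_add hI₁ hI₂, integral_prod _ hI₁, integral_prod _ hI₂, hinit,
    hzero T (hτT.trans hT'), ← integral_add' hI₁.integral_prod_left hI₂.integral_prod_left,
    ← integral_add' (hI₁.integral_prod_left.add hI₂.integral_prod_left)
      (h.integrable_forcing φ)] at hweak
  simp only [Pi.zero_apply, mul_zero, integral_zero, zero_sub] at hweak
  rw [← norm_neg, hweak]
  refine norm_integral_le_of_norm_le_indicators T τ _ _ hτ.le (by positivity) (by positivity) _ ?_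
  have hne : ∀ᵐ t : ℝ, t ≠ 0 := by
    simp [ae_iff]
  filter_upwards [ae_restrict_of_ae hclose, ae_restrict_of_ae hforce, ae_restrict_of_ae hne,
    ae_restrict_mem measurableSet_Icc, hgI.prod_right_ae] with t htc htf ht0 htT hgt
  have htpos : 0 < t := lt_of_le_of_ne htT.1 (Ne.symm ht0)
  have hft := h.integrable t htT
  have hA : ‖∫ x, Function.uncurry f (t, x) * trigPoly s
      (fun k => ((deriv (timeCutoff τ) t : ℝ) : ℂ) * phase α t k) x‖ ≤
      (Icc τ (2 * τ)).indicator (fun _ => K / τ * (M * D₁)) t := by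
    have e : ∀ x, Function.uncurry f (t, x) * trigPoly s
        (fun k => ((deriv (timeCutoff τ) t : ℝ) : ℂ) * phase α t k) x =
        deriv (timeCutoff τ) t * (f t x * trigPoly s (phase α t) x) := fun x => by
      rw [trigPoly_ofReal_mul]
      simp only [Function.uncurry]
      ring
    simp_rw [e]
    rw [integral_const_mul, norm_mul]
    by_cases ht : t ∈ Icc τ (2 * τ)
    · rw [indicator_of_mem ht]
      refine mul_le_mul (hK t) ?_ (norm_nonneg _) (by positivity)
      exact norm_integral_mul_le hpp' hft.aestronglyMeasurable
        (continuous_trigPoly _ _).aestronglyMeasurable M D₁ hM0 hD₁0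
        (hM t ⟨htT.1, ht.2.trans hτT⟩) (hD₁ t ht)
    · rw [indicator_of_notMem ht, deriv_timeCutoff_eq_zero τ t hτ ht, norm_zero, zero_mul]
  have hB : ‖(∫ x, (Function.uncurry f - Function.uncurry g) (t, x) * trigPoly s
      (fun k => Complex.I * omega α k * ((timeCutoff τ t : ℂ) * phase α t k)) x) +
      F t (φ.slice t)‖ ≤
      (Icc 0 (2 * τ)).indicator (fun _ => C₁ * (2 * τ) ^ δ * D₂ + C₂ * D₃) t := by
    have e : ∀ x, (Function.uncurry f - Function.uncurry g) (t, x) * trigPoly s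
        (fun k => Complex.I * omega α k * ((timeCutoff τ t : ℂ) * phase α t k)) x =
        (f t x - g t x) * dispersive α (φ.toFun t) x := fun x => by
      rw [dispersive_freeWave]
      rfl
    simp_rw [e]
    by_cases ht : t < 2 * τ
    · rw [indicator_of_mem (show t ∈ Icc 0 (2 * τ) from ⟨htpos.le, ht.le⟩)]
      refine (norm_add_le _ _).trans (add_le_add ?_ ?_)
      · refine norm_integral_mul_le hpp' (hft.sub hgt).aestronglyMeasurable ?_ _ D₂ (by positivity)
          hD₂0 ((htc ⟨htpos, ht.trans hτt⟩).trans (ENNReal.ofReal_le_ofReal ?_)) (hD₂ t)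
        · rw [funext (dispersive_freeWave α τ t s)]
          exact (continuous_trigPoly _ _).aestronglyMeasurable
        · gcongr
      · have h1 := (htf htT (φ.slice t)).trans (mul_le_mul' le_rfl (hD₃ t))
        rw [← ENNReal.ofReal_mul hC₂, ENNReal.ofReal_le_ofReal_iff (by positivity)] at h1
        exact h1
    -- Past `2τ` the slice is zero and linearity of `F t` kills the forcing.
    · have ht' := not_lt.1 ht
      have hs : φ.slice t = 0 := Subtype.ext (hzero t ht')
      rw [hdisp0 t ht', hs, map_zero]
      simp only [Pi.zero_apply, mul_zero, integral_zero, add_zero, norm_zero]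
      exact indicator_nonneg (fun _ _ => by positivity) t
  rw [Pi.add_apply, Pi.add_apply, add_assoc]
  exact (norm_add_le _ _).trans (add_le_add hA hB)

/-! ### Decay of the low-regularity functionals along a bounded weak solution -/

/-- Coefficients of modulus 1 and the dispersive sup bound are interpolated; relative to `N^(1-1/r)`
the gain is `N^(-ε(1/2-1/r))`. -/
theorem eLpNorm_free_le (α ε t : ℝ) (hα₀ : 0 < α) (hα₁ : α < 1 / 2) (hε : ε ≤ 1) (N : ℕ)
    (hN : 1 ≤ N) (ht₁ : (N : ℝ) ^ (ε - 2 * α) ≤ t) (ht₂ : t * (N : ℝ) ^ (2 * α - 1) ≤ 1 / 2)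
    (r : ℝ≥0∞) (hr : 2 ≤ r) :
    eLpNorm (trigPoly (Finset.Ioc (N : ℤ) (2 * N)) (phase α t)) r volume ≤
      ENNReal.ofReal (7 * (111 / √(2 * α * (1 - 2 * α))) ^ (1 - 2 * (r⁻¹).toReal) *
        (N : ℝ) ^ (1 - (r⁻¹).toReal - ε * (1 / 2 - (r⁻¹).toReal))) := by
  have hN0 : (0 : ℝ) < N := by exact_mod_cast hN
  have hσ : 0 < 2 * α * (1 - 2 * α) := mul_pos (by linarith) (by linarith)
  refine (eLpNorm_trigPoly_le_of_bound N (phase α t) 1 (111 / √(2 * α * (1 - 2 * α)) *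
    (N : ℝ) ^ (1 - ε / 2)) zero_le_one (by positivity) (fun k _ => (norm_phase α t k).le)
    (fun x => ?_) r hr).trans (le_of_eq ?_)
  · refine (Complex.abs_re_le_norm _).trans (le_trans (le_of_eq ?_)
      (norm_sum_dispersive_le (2 * α) ε t (by linarith) (by linarith) hε N hN ht₁ ht₂ x))
    congr 1
    refine Finset.sum_congr rfl fun k hk => ?_
    rw [Finset.mem_Ioc] at hk
    rw [phase, omega_of_pos α k (by omega)]
  · set a := (r⁻¹).toReal
    congr 1
    rw [Real.mul_rpow (by positivity) (by positivity), Real.one_rpow, one_mul,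
      ← Real.rpow_mul hN0.le]
    have : (N : ℝ) ^ ((1 - ε / 2) * (1 - 2 * a)) * (N : ℝ) ^ a =
        (N : ℝ) ^ (1 - a - ε * (1 / 2 - a)) := by
      rw [← Real.rpow_add hN0]; congr 1; ring
    rw [← this]
    ring

theorem eLpNorm_dispersive_freeWave_le (α τ t : ℝ) (hα₀ : 0 < α) (hα₁ : α < 1 / 2) (N : ℕ)
    (hN : 1 ≤ N) (r : ℝ≥0∞) (hr : 2 ≤ r) :
    eLpNorm (dispersive α ((freeWave α τ (Finset.Ioc (N : ℤ) (2 * N))).toFun t)) r volume ≤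
      ENNReal.ofReal (7 * (2 * (N : ℝ) ^ (2 * α)) * (N : ℝ) ^ (1 - (r⁻¹).toReal)) := by
  rw [funext (dispersive_freeWave α τ t _)]
  refine eLpNorm_trigPoly_le N hN _ _ (by positivity) (fun k hk => ?_) r hr
  rw [Finset.mem_Ioc] at hk
  have hk0 : (0 : ℝ) < k := by exact_mod_cast (show (0 : ℤ) < k by omega)
  have hk2 : (k : ℝ) ≤ 2 * N := by exact_mod_cast hk.2
  rw [norm_mul, norm_mul, norm_mul, Complex.norm_I, norm_phase, Complex.norm_real,
    Complex.norm_real, one_mul, mul_one]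
  refine (mul_le_of_le_one_right (norm_nonneg _) (norm_timeCutoff_le _ _)).trans ?_
  rw [omega_of_pos α k (by omega), Real.norm_of_nonneg (by positivity)]
  calc (k : ℝ) ^ (2 * α) ≤ (2 * (N : ℝ)) ^ (2 * α) := by gcongr
    _ = 2 ^ (2 * α) * (N : ℝ) ^ (2 * α) := Real.mul_rpow (by norm_num) (by positivity)
    _ ≤ 2 ^ (1 : ℝ) * (N : ℝ) ^ (2 * α) := by
        gcongr
        · norm_num
        · linarith
    _ = _ := by rw [Real.rpow_one]

theorem tendsto_two_pow_rpow_neg (y : ℝ) (hy : y < 0) :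
    Filter.Tendsto (fun n : ℕ => ((2 ^ n : ℕ) : ℝ) ^ y) Filter.atTop (nhds 0) := by
  have h1 : Filter.Tendsto (fun n : ℕ => ((2 ^ n : ℕ) : ℝ)) Filter.atTop Filter.atTop :=
    tendsto_natCast_atTop_atTop.comp (tendsto_pow_atTop_atTop_of_one_lt one_lt_two)
  have h2 := (tendsto_rpow_neg_atTop (show 0 < -y by linarith)).comp h1
  simpa [Function.comp_def] using h2

/-- The cutoff time `τ = N^(ε-2α)` is long enough for dispersion to act at frequency `N` and short
enough for the two perturbative errors to be negligible. -/
theorem IsWeakSolution.exists_decay {ψ : ℝ → ℝ} (hψ : IsCutoff ψ) {α T T' δ : ℝ} (hα₀ : 0 < α)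
    (hα₁ : α < 1 / 2) (hδ : 0 < δ) {p p' : ℝ≥0∞} (hpp' : p⁻¹ + p'⁻¹ = 1) (hp' : 2 ≤ p')
    {F : ℝ → SmoothFn →ₗ[ℝ] ℝ} {f₀ : Torus → ℝ} {f g : ℝ → Torus → ℝ}
    (h : IsWeakSolution α T F f₀ f g) (hclose : CloseForSmallTimes p δ T f g)
    (hforce : ForcingBound ψ (2 * α - δ) p' T F) (hT' : T' ∈ Ioc 0 T)
    (hsup : (⨆ t ∈ Icc 0 T', eLpNorm (f t) p volume) ≠ ⊤) :
    ∃ C : ℝ, ∃ n₀ : ℕ, ∀ n ≥ n₀, ‖∫ x, f₀ x * trigPoly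
      (Finset.Ioc ((2 ^ n : ℕ) : ℤ) (2 * (2 ^ n : ℕ))) (phase α 0) x‖ ≤
      C * ((2 ^ n : ℕ) : ℝ) ^ (1 - (p'⁻¹).toReal - α * δ / (1 + δ) * (1 / 2 - (p'⁻¹).toReal)) := by
  obtain ⟨K, hK0, hK⟩ := exists_norm_deriv_timeCutoff_le
  obtain ⟨K₃, hK₃0, hK₃⟩ := exists_besovNorm_trigPoly_le hψ (2 * α - δ)
  obtain ⟨C₁, t₀, ht₀, hclose⟩ := hclose
  obtain ⟨C₂, hforce⟩ := hforce
  set M : ℝ := (⨆ t ∈ Icc 0 T', eLpNorm (f t) p volume).toReal with hMdef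
  have hM : ∀ t ∈ Icc 0 T', eLpNorm (f t) p volume ≤ ENNReal.ofReal M := fun t ht => by
    rw [hMdef, ENNReal.ofReal_toReal hsup]
    exact le_iSup₂ (f := fun t (_ : t ∈ Icc 0 T') => eLpNorm (f t) p volume) t ht
  have hM0 : 0 ≤ M := ENNReal.toReal_nonneg
  rw [ae_restrict_iff' measurableSet_Ioo] at hclose
  rw [ae_restrict_iff' measurableSet_Icc] at hforce
  have hclose' : ∀ᵐ t : ℝ, t ∈ Ioo 0 (min t₀ T) →
      eLpNorm (fun x => f t x - g t x) p volume ≤ ENNReal.ofReal (C₁ * t ^ δ) := by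
    filter_upwards [hclose] with t ht htI
    rw [ENNReal.ofReal_mul C₁.coe_nonneg]
    simpa using ht htI
  have hforce' : ∀ᵐ t : ℝ, t ∈ Icc 0 T → ∀ φ : SmoothFn, ENNReal.ofReal |F t φ| ≤
      ENNReal.ofReal C₂ * besovNorm ψ (2 * α - δ) p' (φ : Torus → ℝ) := by
    simpa using hforce
  have ha := inv_toReal_le_half p' hp'
  have ha0 : 0 ≤ (p'⁻¹).toReal := ENNReal.toReal_nonneg
  set a := (p'⁻¹).toReal with hadef
  -- Chosen so that `ε(1+δ) = αδ`: the exponent of `τ^(1+δ) N^(2α)` is then exactly `-αδ`.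
  set ε := α * δ / (1 + δ) with hε
  have hε0 : 0 < ε := by positivity
  have hε1 : ε * (1 + δ) = α * δ := by rw [hε]; field_simp
  have hεα : ε < α := by
    rw [hε, div_lt_iff₀ (by linarith)]; nlinarith
  have hεδ : ε ≤ α * δ := by rw [← hε1]; nlinarith
  set κ := ε * (1 / 2 - a) with hκ
  have hκ0 : 0 ≤ κ := mul_nonneg hε0.le (by linarith)
  have hκε : κ ≤ ε / 2 := by rw [hκ]; nlinarith
  set C₀ : ℝ := (111 / √(2 * α * (1 - 2 * α))) ^ (1 - 2 * a)
  have hC₀ : 0 ≤ C₀ := by positivity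
  have hτ0 := tendsto_two_pow_rpow_neg (ε - 2 * α) (by linarith)
  have hτ1 := tendsto_two_pow_rpow_neg (ε - 1) (by linarith)
  -- For large `n` the wave is extinguished before `T'` and within the range of closeness; the last
  -- condition says `2τ N^(2α-1) ≤ 1/2`, which keeps the phase increments in range.
  have hev : ∀ᶠ n : ℕ in Filter.atTop, ((2 ^ n : ℕ) : ℝ) ^ (ε - 2 * α) < T' / 2 ∧
      ((2 ^ n : ℕ) : ℝ) ^ (ε - 2 * α) < min t₀ T / 2 ∧
      ((2 ^ n : ℕ) : ℝ) ^ (ε - 1) < 1 / 4 := by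
    have hT0 := hT'.1
    have hm : 0 < min t₀ T := lt_min ht₀ (hT'.1.trans_le hT'.2)
    exact (hτ0.eventually_lt_const (by positivity)).and
      ((hτ0.eventually_lt_const (by positivity)).and (hτ1.eventually_lt_const (by norm_num)))
  obtain ⟨n₀, hn₀⟩ := Filter.eventually_atTop.1 hev
  refine ⟨7 * K * M * C₀ + 2 * (C₁ * 2 ^ δ * 14 + C₂ * K₃), n₀, fun n hn => ?_⟩
  obtain ⟨hn1, hn2, hn3⟩ := hn₀ n hn
  have hK₃n := hK₃ n
  set N : ℕ := 2 ^ n with hN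
  have hN1 : 1 ≤ N := Nat.one_le_two_pow
  have hN0 : (0 : ℝ) < N := by exact_mod_cast hN1
  have hN1' : (1 : ℝ) ≤ N := by exact_mod_cast hN1
  set τ : ℝ := (N : ℝ) ^ (ε - 2 * α) with hτ
  have hτpos : 0 < τ := by positivity
  have hmain := h.norm_integral_initial_le (ψ := ψ) (r := 2 * α - δ) (T' := T') (t₁ := min t₀ T)
    (τ := τ) hpp' hδ.le (Finset.Ioc (N : ℤ) (2 * N)) hτpos (by linarith) hT'.2 (by linarith)
    hK0 (fun t => hK τ t hτpos) hM0 hM C₁.coe_nonneg hclose' C₂.coe_nonneg hforce'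
    (D₁ := 7 * C₀ * (N : ℝ) ^ (1 - a - κ)) (by positivity)
    (fun t ht => eLpNorm_free_le α ε t hα₀ hα₁ (by linarith) N hN1 ht.1 (by
      refine (mul_le_mul_of_nonneg_right ht.2 (by positivity)).trans ?_
      rw [mul_assoc, hτ, ← Real.rpow_add hN0,
        show ε - 2 * α + (2 * α - 1) = ε - 1 by ring]
      linarith) p' hp')
    (D₂ := 7 * (2 * (N : ℝ) ^ (2 * α)) * (N : ℝ) ^ (1 - a)) (by positivity)
    (fun t => eLpNorm_dispersive_freeWave_le α τ t hα₀ hα₁ N hN1 p' hp')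
    (D₃ := K₃ * 1 * (N : ℝ) ^ (2 * α - δ + (1 - a))) (by positivity)
    (fun t => hK₃n _ 1 zero_le_one (fun k _ => by
      rw [norm_mul, norm_phase, Complex.norm_real, mul_one]
      exact norm_timeCutoff_le _ _) p' hp')
  refine hmain.trans ?_
  have hpow : ∀ y : ℝ, y ≤ 1 - a - κ → (N : ℝ) ^ y ≤ (N : ℝ) ^ (1 - a - κ) := fun y hy =>
    Real.rpow_le_rpow_of_exponent_le hN1' hy
  have e1 : τ * (K / τ * (M * (7 * C₀ * (N : ℝ) ^ (1 - a - κ)))) =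
      7 * K * M * C₀ * (N : ℝ) ^ (1 - a - κ) := by
    field_simp
  -- The exponent here is `1 - a - αδ`, and `κ ≤ ε/2 ≤ αδ`.
  have e2 : τ * (2 * τ) ^ δ * ((N : ℝ) ^ (2 * α) * (N : ℝ) ^ (1 - a)) ≤
      2 ^ δ * (N : ℝ) ^ (1 - a - κ) := by
    rw [Real.mul_rpow zero_le_two hτpos.le, hτ, ← Real.rpow_mul hN0.le]
    have : (N : ℝ) ^ (ε - 2 * α) * (2 ^ δ * (N : ℝ) ^ ((ε - 2 * α) * δ)) *
        ((N : ℝ) ^ (2 * α) * (N : ℝ) ^ (1 - a)) =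
        2 ^ δ * (N : ℝ) ^ (ε - 2 * α + (ε - 2 * α) * δ + (2 * α + (1 - a))) := by
      rw [Real.rpow_add hN0, Real.rpow_add hN0 (ε - 2 * α), Real.rpow_add hN0 (2 * α)]
      ring
    rw [this]
    refine mul_le_mul_of_nonneg_left (hpow _ ?_) (by positivity)
    nlinarith
  -- The exponent is `1 - a + ε - δ`; `ε + κ ≤ 3ε/2 ≤ δ` since `ε ≤ αδ` and `α < 1/2`.
  have e3 : τ * (N : ℝ) ^ (2 * α - δ + (1 - a)) ≤ (N : ℝ) ^ (1 - a - κ) := by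
    rw [hτ, ← Real.rpow_add hN0]
    refine hpow _ ?_
    nlinarith
  have hC₁ : (0 : ℝ) ≤ C₁ := C₁.coe_nonneg
  have hC₂ : (0 : ℝ) ≤ C₂ := C₂.coe_nonneg
  have e4 := mul_le_mul_of_nonneg_left e2 hC₁
  have e5 := mul_le_mul_of_nonneg_left e3 (mul_nonneg hC₂ hK₃0)
  rw [e1]
  linarith

/-! ### The initial datum -/

theorem trigPoly_phase_zero_neg (α : ℝ) (s : Finset ℤ) (x : Torus) :
    trigPoly s (phase α 0) (-x) = trigPoly s (phase α 0) x := by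
  simp only [trigPoly, phase, zero_mul, Complex.ofReal_zero, Complex.exp_zero, one_mul,
    Complex.re_sum]
  refine Finset.sum_congr rfl fun k _ => ?_
  have : (fourier k (-x) : ℂ) = fourier (-k) x := by
    rw [fourier_apply, fourier_apply, smul_neg, neg_smul]
  rw [this, fourier_neg, Complex.conj_re]

/-- On this ball `|kx| ≤ 1` for all `k ≤ 2N`, so each of the `N` cosines is at least `1/2`. -/
theorem le_trigPoly_phase_zero (α : ℝ) (N : ℕ) (hN : 1 ≤ N) (x : Torus)
    (hx : x ∈ Metric.closedBall (0 : Torus) (1 / (2 * N))) :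
    (N : ℝ) / 2 ≤ trigPoly (Finset.Ioc (N : ℤ) (2 * N)) (phase α 0) x := by
  obtain ⟨y, hy, rfl⟩ := exists_coe_eq x
  have hN0 : (0 : ℝ) < N := by exact_mod_cast hN
  rw [mem_closedBall_zero_iff, (AddCircle.norm_coe_eq_abs_iff (2 * Real.pi)
    Real.two_pi_pos.ne').2 (by
      rw [abs_of_pos Real.two_pi_pos]; linarith), le_div_iff₀ (by positivity)] at hx
  simp only [trigPoly, phase, zero_mul, Complex.ofReal_zero, Complex.exp_zero, one_mul,
    Complex.re_sum]
  have h := Finset.card_nsmul_le_sum (Finset.Ioc (N : ℤ) (2 * N))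
    (fun k => (fourier k (y : Torus) : ℂ).re) (1 / 2) fun k hk => by
      rw [Finset.mem_Ioc] at hk
      rw [fourier_torus_apply, Complex.exp_ofReal_mul_I_re]
      have hk0 : (0 : ℝ) < k := by exact_mod_cast (show (0 : ℤ) < k by omega)
      have hk2 : (k : ℝ) ≤ 2 * N := by exact_mod_cast hk.2
      have hky : |(k : ℝ) * y| ≤ 1 := by
        rw [abs_mul, abs_of_pos hk0]
        nlinarith [abs_nonneg y]
      have := Real.one_sub_sq_div_two_le_cos (x := (k : ℝ) * y)
      have h2 : ((k : ℝ) * y) ^ 2 ≤ 1 := by rw [sq_le_one_iff_abs_le_one]; exact hky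
      linarith
  rw [card_Ioc_int, nsmul_eq_mul] at h
  linarith

/-- Integration against a continuous function, as a continuous functional on `L^p`. -/
theorem exists_integral_mul_clm (p : ℝ≥0∞) [Fact (1 ≤ p)] (V : Torus → ℝ) (hV : Continuous V) :
    ∃ ℓ : Lp ℝ p (volume : Measure Torus) →L[ℝ] ℝ, ∀ g, ℓ g = ∫ x, g x * V x := by
  obtain ⟨B, hB⟩ := (HasCompactSupport.of_compactSpace V).exists_bound_of_continuous hV
  have hB0 : 0 ≤ B := (norm_nonneg _).trans (hB 0)
  have hint : ∀ g : Lp ℝ p (volume : Measure Torus), Integrable (fun x => g x * V x) volume :=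
    fun g => ((Lp.memLp g).integrable Fact.out).mul_bdd hV.aestronglyMeasurable
      (Filter.Eventually.of_forall hB)
  have hconj : p⁻¹ + (1 - p⁻¹) = 1 :=
    add_tsub_cancel_of_le (ENNReal.inv_le_one.2 Fact.out)
  have hVL : MemLp V (1 - p⁻¹)⁻¹ (volume : Measure Torus) :=
    MemLp.of_bound hV.aestronglyMeasurable B (Filter.Eventually.of_forall hB)
  refine ⟨LinearMap.mkContinuous ⟨⟨fun g => ∫ x, g x * V x, fun g h => ?_⟩, fun c g => ?_⟩
    (eLpNorm V (1 - p⁻¹)⁻¹ volume).toReal fun g => ?_, fun g => rfl⟩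
  · rw [← integral_add (hint g) (hint h)]
    refine integral_congr_ae ?_
    filter_upwards [Lp.coeFn_add g h] with x hx
    rw [hx, Pi.add_apply, add_mul]
  · simp only [RingHom.id_apply, smul_eq_mul]
    rw [← integral_const_mul]
    refine integral_congr_ae ?_
    filter_upwards [Lp.coeFn_smul c g] with x hx
    rw [hx, Pi.smul_apply, smul_eq_mul, mul_assoc]
  · refine le_of_le_of_eq ?_ (mul_comm _ _)
    refine norm_integral_mul_le (p := p) (p' := (1 - p⁻¹)⁻¹) (by rw [inv_inv, hconj])
      (Lp.aestronglyMeasurable g) hV.aestronglyMeasurable _ _ (norm_nonneg _)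
      ENNReal.toReal_nonneg ?_ ?_
    · rw [Lp.norm_def, ENNReal.ofReal_toReal (Lp.eLpNorm_ne_top g)]
    · rw [ENNReal.ofReal_toReal hVL.eLpNorm_ne_top]

/-- Otherwise the functionals scaled by `N^(-e)` would be pointwise bounded, hence uniformly
bounded. But the indicator of the ball of radius `1/(2N)` has norm `N^(-1/p)` and pairing at least
`1/2`, so the norms grow like `N^(1/p-e)`. -/
theorem exists_unbounded_functionals (α : ℝ) (p : ℝ≥0∞) [Fact (1 ≤ p)] (hp : p ≠ ⊤) (e : ℝ)
    (he : e < (p⁻¹).toReal) :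
    ∃ g : Lp ℝ p (volume : Measure Torus), ∀ (C : ℝ) (n₀ : ℕ), ∃ n ≥ n₀,
      C * ((2 ^ n : ℕ) : ℝ) ^ e < ‖∫ x, g x * trigPoly
        (Finset.Ioc ((2 ^ n : ℕ) : ℤ) (2 * (2 ^ n : ℕ))) (phase α 0) x‖ := by
  by_contra! hcon
  have hp0 : p ≠ 0 := (zero_lt_one.trans_le (Fact.out : 1 ≤ p)).ne'
  choose ℓ hℓ using fun n : ℕ => exists_integral_mul_clm p (trigPoly
    (Finset.Ioc ((2 ^ n : ℕ) : ℤ) (2 * (2 ^ n : ℕ))) (phase α 0)) (continuous_trigPoly _ _)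
  have hNpos : ∀ n : ℕ, (0 : ℝ) < ((2 ^ n : ℕ) : ℝ) := fun n => by positivity
  obtain ⟨C', hC'⟩ := banach_steinhaus
    (g := fun n => (((2 ^ n : ℕ) : ℝ) ^ (-e)) • ℓ n) fun g => by
      obtain ⟨C, n₀, hC⟩ := hcon g
      -- The sum absorbs the finitely many `n < n₀` about which the assumed bound is silent.
      refine ⟨|C| + ∑ m ∈ Finset.range n₀, ‖((((2 ^ m : ℕ) : ℝ) ^ (-e)) • ℓ m) g‖, fun n => ?_⟩
      have hs : 0 ≤ ∑ m ∈ Finset.range n₀, ‖((((2 ^ m : ℕ) : ℝ) ^ (-e)) • ℓ m) g‖ :=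
        Finset.sum_nonneg fun _ _ => norm_nonneg _
      rcases Nat.lt_or_ge n n₀ with hn | hn
      · have := Finset.single_le_sum
          (f := fun m : ℕ => ‖((((2 ^ m : ℕ) : ℝ) ^ (-e)) • ℓ m) g‖)
          (fun _ _ => norm_nonneg _) (Finset.mem_range.2 hn)
        linarith [abs_nonneg C]
      · have h1 := hC n hn
        rw [← hℓ] at h1
        rw [smul_apply, norm_smul, Real.norm_of_nonneg
          (Real.rpow_nonneg (hNpos n).le _)]
        have h2 := mul_le_mul_of_nonneg_left h1 (Real.rpow_nonneg (hNpos n).le (-e))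
        have h3 : ((2 ^ n : ℕ) : ℝ) ^ (-e) * (C * ((2 ^ n : ℕ) : ℝ) ^ e) = C := by
          rw [mul_left_comm, ← Real.rpow_add (hNpos n)]; simp
        linarith [le_abs_self C]
  have hbound : ∀ n : ℕ, 1 / 2 ≤ C' * ((2 ^ n : ℕ) : ℝ) ^ (e - (p⁻¹).toReal) := by
    intro n
    have hCn := hC' n
    have hℓn := hℓ n
    have hN := hNpos n
    have hN1 : 1 ≤ 2 ^ n := Nat.one_le_two_pow
    set N : ℕ := 2 ^ n
    have hN1' : (1 : ℝ) ≤ N := by exact_mod_cast hN1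
    set b := Metric.closedBall (0 : Torus) (1 / (2 * N))
    have hb : MeasurableSet b := measurableSet_closedBall
    have hvol : volume b = ENNReal.ofReal (1 / N) := by
      rw [AddCircle.volume_closedBall, min_eq_right]
      · congr 1; field_simp
      · have : 2 * (1 / (2 * (N : ℝ))) ≤ 1 := by
          rw [show 2 * (1 / (2 * (N : ℝ))) = 1 / N by field_simp, div_le_one hN]
          exact hN1'
        linarith [Real.pi_gt_three]
    have hfin : volume b ≠ ⊤ := by rw [hvol]; exact ENNReal.ofReal_ne_top
    have hreal : (volume : Measure Torus).real b = 1 / N := by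
      rw [Measure.real, hvol, ENNReal.toReal_ofReal (by positivity)]
    set V := trigPoly (Finset.Ioc (N : ℤ) (2 * N)) (phase α 0) with hV
    have hVc : Continuous V := continuous_trigPoly _ _
    have hval : 1 / 2 ≤ ℓ n (indicatorConstLp p hb hfin 1) := by
      rw [hℓn]
      have h1 : ∫ x, indicatorConstLp p hb hfin (1 : ℝ) x * V x = ∫ x in b, V x := by
        rw [← integral_indicator hb]
        refine integral_congr_ae ?_
        filter_upwards [indicatorConstLp_coeFn (p := p) (hs := hb) (hμs := hfin) (c := (1 : ℝ))]
          with x hx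
        rw [hx]
        by_cases hxb : x ∈ b <;> simp [hxb]
      rw [h1]
      have h2 : ∫ _ in b, (N : ℝ) / 2 ≤ ∫ x in b, V x :=
        setIntegral_mono_on (integrableOn_const hfin)
          (hVc.integrable_of_hasCompactSupport (HasCompactSupport.of_compactSpace _)).integrableOn
          hb fun x hx => le_trigPoly_phase_zero α N hN1 x hx
      rw [setIntegral_const, hreal, smul_eq_mul] at h2
      refine le_trans (le_of_eq ?_) h2
      field_simp
    have hle := ((((N : ℝ) ^ (-e)) • ℓ n).le_opNorm (indicatorConstLp p hb hfin 1)).trans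
      (mul_le_mul_of_nonneg_right hCn (norm_nonneg _))
    rw [smul_apply, norm_smul, Real.norm_of_nonneg
      (Real.rpow_nonneg hN.le _), norm_indicatorConstLp hp0 hp, hreal, norm_one, one_mul,
      one_div (N : ℝ), Real.inv_rpow hN.le, ← Real.rpow_neg hN.le] at hle
    have h3 : 1 / 2 ≤ ‖ℓ n (indicatorConstLp p hb hfin 1)‖ := hval.trans (Real.le_norm_self _)
    have h4 := (mul_le_mul_of_nonneg_left h3 (Real.rpow_nonneg hN.le (-e))).trans hle
    have h5 := mul_le_mul_of_nonneg_left h4 (Real.rpow_nonneg hN.le e)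
    rw [← mul_assoc, ← Real.rpow_add hN, add_neg_cancel, Real.rpow_zero, one_mul,
      mul_left_comm, ← Real.rpow_add hN] at h5
    rw [ENNReal.toReal_inv, sub_eq_add_neg, ← one_div]
    exact h5
  have hlim := (tendsto_two_pow_rpow_neg (e - (p⁻¹).toReal) (by linarith)).const_mul C'
  rw [mul_zero] at hlim
  have := ge_of_tendsto' hlim hbound
  norm_num at this

/-- The kernel is even, so replacing the datum by its even part changes no pairing. -/
theorem exists_even_unbounded_functionals (α : ℝ) (p : ℝ≥0∞) (hp₁ : 1 ≤ p) (hp : p ≠ ⊤) (e : ℝ)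
    (he : e < (p⁻¹).toReal) :
    ∃ f₀ : Torus → ℝ, (∀ x, f₀ (-x) = f₀ x) ∧ MemLp f₀ p volume ∧ ∀ (C : ℝ) (n₀ : ℕ), ∃ n ≥ n₀,
      C * ((2 ^ n : ℕ) : ℝ) ^ e < ‖∫ x, f₀ x * trigPoly
        (Finset.Ioc ((2 ^ n : ℕ) : ℤ) (2 * (2 ^ n : ℕ))) (phase α 0) x‖ := by
  have : Fact (1 ≤ p) := ⟨hp₁⟩
  obtain ⟨g, hg⟩ := exists_unbounded_functionals α p hp e he
  have hmem : MemLp g p volume := Lp.memLp g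
  have hmem' : MemLp (fun x => g (-x)) p volume :=
    hmem.comp_measurePreserving (Measure.measurePreserving_neg volume)
  refine ⟨fun x => 1 / 2 * (g x + g (-x)), fun x => by simp only [neg_neg]; rw [add_comm],
    (hmem.add hmem').const_mul _, fun C n₀ => ?_⟩
  obtain ⟨n, hn, hlt⟩ := hg C n₀
  refine ⟨n, hn, hlt.trans_le (le_of_eq ?_)⟩
  set V := trigPoly (Finset.Ioc ((2 ^ n : ℕ) : ℤ) (2 * (2 ^ n : ℕ))) (phase α 0) with hV
  have hVc : Continuous V := continuous_trigPoly _ _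
  obtain ⟨B, hB⟩ := (HasCompactSupport.of_compactSpace V).exists_bound_of_continuous hVc
  have hint : ∀ u : Torus → ℝ, MemLp u p volume → Integrable (fun x => u x * V x) volume :=
    fun u hu => (hu.integrable hp₁).mul_bdd hVc.aestronglyMeasurable
      (Filter.Eventually.of_forall hB)
  have hsymm : ∫ x, g (-x) * V x = ∫ x, g x * V x := by
    rw [← integral_neg_eq_self (fun x => g x * V x)]
    refine integral_congr_ae (Filter.Eventually.of_forall fun x => ?_)
    simp only
    rw [hV, trigPoly_phase_zero_neg]
  congr 1
  have : ∀ x, 1 / 2 * (g x + g (-x)) * V x = 1 / 2 * (g x * V x + g (-x) * V x) := fun x => by ring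
  simp_rw [this]
  rw [integral_const_mul, integral_add (hint _ hmem) (hint _ hmem'), hsymm]
  ring

end AlphaModel

end

/-! ### Proof of the proposition -/

theorem proposition6p2 (ψ : ℝ → ℝ) (hψ : AlphaModel.IsCutoff ψ)
    (α : ℝ) (hα₀ : 0 < α) (hα₁ : α < 1 / 2)
    (p p' : ℝ≥0∞) (hp₁ : 1 ≤ p) (hp₂ : p < 2) (hpp' : p⁻¹ + p'⁻¹ = 1)
    (δ : ℝ) (hδ : 0 < δ) :
    ∃ f₀ : AlphaModel.Torus → ℝ,
      (∀ x, f₀ (-x) = f₀ x) ∧ MemLp f₀ p volume ∧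
      ∀ (T : ℝ), 0 < T →
      ∀ (bar : (ℝ → AlphaModel.Torus → ℝ) → ℝ → AlphaModel.Torus → ℝ)
        (F : ℝ → AlphaModel.SmoothFn →ₗ[ℝ] ℝ) (f : ℝ → AlphaModel.Torus → ℝ),
        AlphaModel.IsWeakSolution α T F f₀ f (bar f) →
        AlphaModel.CloseForSmallTimes p δ T f (bar f) →
        AlphaModel.ForcingBound ψ (2 * α - δ) p' T F →
        ∀ T' ∈ Ioc 0 T, (⨆ t ∈ Icc 0 T', eLpNorm (f t) p volume) = ⊤ := by
  have hp0 : p ≠ 0 := (zero_lt_one.trans_le hp₁).ne'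
  have hptop : p ≠ ⊤ := (hp₂.trans_le le_top).ne
  have hinvp : p⁻¹ ≠ ⊤ := ENNReal.inv_ne_top.2 hp0
  have hinvp' : p'⁻¹ ≠ ⊤ := fun h => by rw [h, add_top] at hpp'; exact ENNReal.top_ne_one hpp'
  have hsum : (p⁻¹).toReal + (p'⁻¹).toReal = 1 := by
    rw [← ENNReal.toReal_add hinvp hinvp', hpp', ENNReal.toReal_one]
  have hhalf : 1 / 2 < (p⁻¹).toReal := by
    have h := (ENNReal.toReal_lt_toReal (by norm_num) hinvp).2 (ENNReal.inv_lt_inv.2 hp₂)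
    rw [ENNReal.toReal_inv 2] at h
    simpa using h
  have hp' : 2 ≤ p' := by
    rw [← ENNReal.inv_le_inv, ← ENNReal.toReal_le_toReal hinvp' (by norm_num),
      ENNReal.toReal_inv 2, ENNReal.toReal_ofNat]
    linarith
  -- The decay exponent of bounded solutions lies strictly below `1/p = 1 - 1/p'` because `1/p' <
  -- 1/2`.
  obtain ⟨f₀, heven, hmem, hunb⟩ := AlphaModel.exists_even_unbounded_functionals α p hp₁ hptop
    (1 - (p'⁻¹).toReal - α * δ / (1 + δ) * (1 / 2 - (p'⁻¹).toReal)) (by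
      have : 0 < α * δ / (1 + δ) * (1 / 2 - (p'⁻¹).toReal) :=
        mul_pos (by positivity) (by linarith)
      linarith)
  refine ⟨f₀, heven, hmem, fun T _ bar F f h hclose hforce T' hT' => ?_⟩
  by_contra hsup
  obtain ⟨C, n₀, hC⟩ := h.exists_decay hψ hα₀ hα₁ hδ hpp' hp' hclose hforce hT' hsup
  obtain ⟨n, hn, hlt⟩ := hunb C n₀
  exact absurd (hC n hn) (not_le.2 hlt)
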